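/- **Setting.** Let $\ell^2(\{o\}\sqcup\mathbb Z)$ be the boolean Fock space on $\ell^2(\mathbb Z)$, with canonical orthonormal basis $e_o$ (the vacuum), $e_j$ ($j\in\mathbb Z$), and let $\mathfrak B$ be the $C^*$-algebra generated by the identity $I$ and the boolean creators $b_j^\dagger=\langle\,\cdot\,,e_o\rangle e_j$, $j\in\mathbb Z$ (it consists of the operators $A+bI$ with $A$ compact and $b\in\mathbb C$). Let $V$ be the unitary with $Ve_o=e_o$, $Ve_j=e_{j+1}$, let $s=\mathrm{Ad}_V$ be the shift of $\mathfrak B$, so that $s(b_j^\dagger)=b_{j+1}^\dagger$, let $P$ be the orthogonal projection onto $\mathbb Ce_o$, and for $A$ compact and $b\in\mathbb C$ put $$\mathcal E_1(A+bI)=\big(\langle Ae_o,e_o\rangle+b\big)P+b\,(I-P).$$ Let $\theta\in\mathbb R$ be irrational, $\mathfrak A=C(\mathbb T;\mathfrak B)=C(\mathbb T)\otimes\mathfrak B$, and $$\alpha(f)(z)=s\big(f(e^{2\pi i\theta}z)\big),\qquad E_1(f)=\oint\mathcal E_1(f(z))\,\frac{dz}{2\pi i z}\ \text{ (a constant function)},\qquad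 f\in\mathfrak A,\ z\in\mathbb T .$$ For $l\in\mathbb Z$ put $\lambda_l=e^{2\pi i l\theta}$ and $u_l(z)=z^lI$. Let $\mathfrak A_\lambda=\{f\in\mathfrak A:\alpha(f)=\lambda f\}$ for $\lambda\in\mathbb T$, let $\sigma_{\rm pp}(\alpha)=\{\lambda\in\mathbb T:\mathfrak A_\lambda\neq0\}$, and let $\sigma^{(\rm f)}_{\rm pp}(\alpha)$ be the set of all $\lambda\in\mathbb T$ that are, for some $\alpha$-invariant state $\varphi$ of $\mathfrak A$, an eigenvalue of the isometry $V_\varphi$ of the GNS space of $\varphi$ given by $V_\varphi\pi_\varphi(f)\xi_\varphi=\pi_\varphi(\alpha(f))\xi_\varphi$. **Proposition.** 1. $(\mathfrak A,\alpha)$ is uniquely ergodic with respect to its fixed-point subalgebra $\mathfrak A_1$, with expectation $E_1$: every bounded linear functional (respectively, every state) of $\mathfrak A_1$ has a unique $\alpha$-invariant extension to a bounded linear functional (respectively, a state) of $\mathfrak A$, the map $E_1$ is an $\alpha$-invariant conditional expectation of $\mathfrak A$ onto $\mathfrak A_1$, and $\frac1n\sum_{k=0}^{n-1}\alpha^k(f)\to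 E_1(f)$ in norm for every $f\in\mathfrak A$. Moreover, $\mathfrak A_1$ consists of the constant functions with values in $\mathbb CP\oplus\mathbb C(I-P)$. 2. $\sigma_{\rm pp}(\alpha)=\{e^{2\pi i l\theta}: l\in\mathbb Z\}=\sigma_{\rm pp}^{(\rm f)}(\alpha)$. For every $l\in\mathbb Z$, $u_l$ is a unitary element of $\mathfrak A_{\lambda_l}$, and $\mathfrak A_{\lambda_l}=u_l\mathfrak A_1=\mathfrak A_1u_l$. 3. For all $f\in\mathfrak A$ and $\lambda\in\mathbb T$, in norm, $$\lim_{n\to\infty}\frac1n\sum_{k=0}^{n-1}\lambda^{-k}\alpha^k(f)=\begin{cases}\left(\oint\mathcal E_1(f(z))\,\dfrac{dz}{2\pi i z^{l+1}}\right)u_l&\text{if }\lambda=\lambda_l\text{ for some }l\in\mathbb Z,\\[2mm]0&\text{if }\lambda\neq\lambda_l\text{ for all }l\in\mathbb Z.\end{cases}$$ -/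

import Mathlib

open Filter Topology

namespace BooleanRotation

noncomputable section

/-! ### Discrete C⋆-dynamical systems -/

section General

open scoped ComplexOrder

/-- A state of a unital complex `⋆`-algebra: a linear functional `φ` with `φ(a⋆a) ≥ 0` for all `a`
and `φ(1) = 1`. -/
structure State (A : Type*) [Ring A] [StarRing A] [Algebra ℂ A] where
  toLinearMap : A →ₗ[ℂ] ℂ
  nonneg : ∀ a : A, 0 ≤ toLinearMap (star a * a)
  map_one : toLinearMap 1 = 1

variable {A : Type*} [CStarAlgebra A]

/-- The unital `⋆`-endomorphisms of `A`. -/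
abbrev Endo (A : Type*) [CStarAlgebra A] : Type _ := A →⋆ₐ[ℂ] A

/-- The fixed-point subalgebra `{a | Φ a = a}`. -/
def fixedPoints (Φ : Endo A) : StarSubalgebra ℂ A :=
  StarAlgHom.equalizer Φ (StarAlgHom.id ℂ A)

/-- The eigenspace `{a | Φ a = lam • a}`. -/
def eigenspace (Φ : Endo A) (lam : Circle) : Submodule ℂ A :=
  Module.End.eigenspace (Φ : A →ₗ[ℂ] A) (lam : ℂ)

/-- The (peripheral) pure-point spectrum: the eigenvalues of `Φ` on the unit circle. -/
def purePointSpectrum (Φ : Endo A) : Set Circle :=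
  {lam | Module.End.HasEigenvalue (Φ : A →ₗ[ℂ] A) (lam : ℂ)}

/-- The averages `(1/n) ∑_{k=0}^{n-1} lam^{-k} Φ^k(a)`. -/
def cesaro (Φ : Endo A) (lam : Circle) (a : A) (n : ℕ) : A :=
  (n : ℂ)⁻¹ • ∑ k ∈ Finset.range n, ((lam : ℂ) ^ (-(k : ℤ))) • (Φ^[k] a)

/-- Invariance of a state under `Φ`. -/
def State.IsInvariant (φ : State A) (Φ : Endo A) : Prop :=
  ∀ a, φ.toLinearMap (Φ a) = φ.toLinearMap a

/-- `E` is a conditional expectation of `A` onto the subalgebra `S`: a linear positive contractive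
projection onto `S` which is an `S`-bimodule map. -/
structure IsConditionalExpectation (S : StarSubalgebra ℂ A) (E : A → A) : Prop where
  map_add : ∀ a b, E (a + b) = E a + E b
  map_smul : ∀ (c : ℂ) (a : A), E (c • a) = c • E a
  mem : ∀ a, E a ∈ S
  fixes : ∀ a ∈ S, E a = a
  norm_le : ∀ a, ‖E a‖ ≤ ‖a‖
  positive : ∀ a, ∃ c, E (star a * a) = star c * c
  bimodule : ∀ b ∈ S, ∀ c ∈ S, ∀ a, E (b * a * c) = b * E a * c

/-- Unique ergodicity of `(A, Φ)` with respect to the fixed-point subalgebra, with expectation `E`.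
The usual equivalent forms are recorded together: bounded functionals, resp. states, of the
fixed-point subalgebra have unique `Φ`-invariant extensions of the same kind to `A`, and the ergodic
averages converge pointwise in norm to the `Φ`-invariant conditional expectation `E` onto the
fixed-point subalgebra. -/
structure IsUniquelyErgodicWithExpectation (Φ : Endo A) (E : A → A) : Prop where
  functional_extension : ∀ ψ : fixedPoints Φ →L[ℂ] ℂ,
    ∃! χ : A →L[ℂ] ℂ, (∀ a, χ (Φ a) = χ a) ∧ ∀ a : fixedPoints Φ, χ (a : A) = ψ a
  state_extension : ∀ ψ : State (fixedPoints Φ),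
    ∃! χ : State A, χ.IsInvariant Φ ∧
      ∀ a : fixedPoints Φ, χ.toLinearMap (a : A) = ψ.toLinearMap a
  expectation : IsConditionalExpectation (fixedPoints Φ) E
  invariant : ∀ a, E (Φ a) = E a
  tendsto : ∀ a, Tendsto (cesaro Φ 1 a) atTop (𝓝 (E a))

section GNS

attribute [local instance] CStarAlgebra.spectralOrder CStarAlgebra.spectralOrderedRing

/-- A state as a positive linear map, for the order of the C⋆-algebra `A`. -/
def State.toPositive (φ : State A) : A →ₚ[ℂ] ℂ :=
  PositiveLinearMap.mk₀ φ.toLinearMap fun a ha => by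
    obtain ⟨b, rfl⟩ := CStarAlgebra.nonneg_iff_eq_star_mul_self.mp ha
    exact φ.nonneg b

/-- The Hilbert space of the GNS representation of a state. -/
abbrev State.GNS (φ : State A) : Type _ := φ.toPositive.GNS

/-- The isometry `V` of the covariant GNS representation of an invariant state, on the dense
subspace of the vectors `π(a)ξ`, where it is `π(a)ξ ↦ π(Φ a)ξ`. -/
def State.preCovariantIsometry (φ : State A) (Φ : Endo A) (h : φ.IsInvariant Φ) :
    φ.toPositive.PreGNS →L[ℂ] φ.toPositive.PreGNS :=
  LinearMap.mkContinuous
    (φ.toPositive.toPreGNS.toLinearMap ∘ₗ (Φ : A →ₗ[ℂ] A) ∘ₗ φ.toPositive.ofPreGNS.toLinearMap) 1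
    fun x => by
      have key : φ.toPositive (star (Φ (φ.toPositive.ofPreGNS x)) * Φ (φ.toPositive.ofPreGNS x))
          = φ.toPositive (star (φ.toPositive.ofPreGNS x) * φ.toPositive.ofPreGNS x) := by
        rw [← map_star, ← map_mul]
        exact h _
      rw [one_mul, PositiveLinearMap.preGNS_norm_def, PositiveLinearMap.preGNS_norm_def]
      exact le_of_eq (congrArg (fun c : ℂ => √c.re) key)

/-- The isometry `V` of the covariant GNS representation of an invariant state. -/
def State.covariantIsometry (φ : State A) (Φ : Endo A) (h : φ.IsInvariant Φ) :
    φ.GNS →L[ℂ] φ.GNS :=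
  (φ.preCovariantIsometry Φ h).completion

theorem State.covariantIsometry_coe (φ : State A) (Φ : Endo A) (h : φ.IsInvariant Φ) (a : A) :
    φ.covariantIsometry Φ h ((φ.toPositive.toPreGNS a : φ.toPositive.PreGNS) : φ.GNS) =
      ((φ.toPositive.toPreGNS (Φ a) : φ.toPositive.PreGNS) : φ.GNS) :=
  ContinuousLinearMap.completion_apply_coe _ _

/-- The full (peripheral) pure-point spectrum: the union, over all invariant states `φ`, of the sets
of unimodular eigenvalues of the isometry of the covariant GNS representation of `φ`. -/
def fullPurePointSpectrum (Φ : Endo A) : Set Circle :=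
  {lam | ∃ (φ : State A) (h : φ.IsInvariant Φ),
    Module.End.HasEigenvalue (φ.covariantIsometry Φ h : φ.GNS →ₗ[ℂ] φ.GNS) (lam : ℂ)}

end GNS

end General

/-! ### The boolean C⋆-algebra and its shift -/

section Boolean

open scoped InnerProductSpace

/-- The boolean Fock space `ℓ²({o} ⊔ ℤ)`; the index `none` stands for the vacuum `o`. -/
abbrev Fock : Type := lp (fun _ : Option ℤ => ℂ) 2

/-- The canonical orthonormal basis of the Fock space. -/
def stdBasis : HilbertBasis (Option ℤ) ℂ Fock :=
  HilbertBasis.ofRepr (LinearIsometryEquiv.refl ℂ Fock)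

/-- The boolean creator `b†_j`: it maps the vacuum vector to `e_j` and every `e_i` to `0`. -/
def creator (j : ℤ) : Fock →L[ℂ] Fock :=
  InnerProductSpace.rankOne ℂ (stdBasis (some j)) (stdBasis none)

/-- The boolean C⋆-algebra: the C⋆-algebra generated by the identity and the creators. -/
def boole : StarSubalgebra ℂ (Fock →L[ℂ] Fock) :=
  (StarAlgebra.adjoin ℂ (Set.range creator)).topologicalClosure

instance isClosed_boole : IsClosed (boole : Set (Fock →L[ℂ] Fock)) :=
  StarSubalgebra.isClosed_topologicalClosure _

theorem creator_mem (j : ℤ) : creator j ∈ boole :=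
  StarSubalgebra.le_topologicalClosure _ (StarAlgebra.subset_adjoin ℂ _ ⟨j, rfl⟩)

/-- The permutation of `{o} ⊔ ℤ` with `o ↦ o` and `j ↦ j + 1`. -/
def shiftIndex : Option ℤ ≃ Option ℤ := Equiv.optionCongr (Equiv.addRight (1 : ℤ))

/-- The canonical basis, re-indexed by the shift. -/
def shiftedBasis : HilbertBasis (Option ℤ) ℂ Fock :=
  HilbertBasis.mk (v := fun i => stdBasis (shiftIndex i))
    (stdBasis.orthonormal.comp _ shiftIndex.injective) (by
      have : Set.range (fun i => stdBasis (shiftIndex i)) = Set.range stdBasis :=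
        shiftIndex.surjective.range_comp stdBasis
      rw [this, stdBasis.dense_span])

/-- The unitary `V` on the Fock space with `V e_o = e_o` and `V e_j = e_{j+1}`. -/
def shiftUnitary : Fock ≃ₗᵢ[ℂ] Fock := stdBasis.repr.trans shiftedBasis.repr.symm

theorem shiftUnitary_apply (i : Option ℤ) :
    shiftUnitary (stdBasis i) = stdBasis (shiftIndex i) := by
  change shiftedBasis.repr.symm (stdBasis.repr (stdBasis i)) = _
  rw [HilbertBasis.repr_self, HilbertBasis.repr_symm_single]
  exact congrFun (HilbertBasis.coe_mk _ _) i

theorem shiftUnitary_vacuum : shiftUnitary (stdBasis none) = stdBasis none :=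
  shiftUnitary_apply none

theorem shiftUnitary_some (j : ℤ) :
    shiftUnitary (stdBasis (some j)) = stdBasis (some (j + 1)) :=
  shiftUnitary_apply (some j)

/-- `Ad_V` maps `b†_j` to `b†_{j+1}`. -/
theorem conj_creator (j : ℤ) :
    shiftUnitary.conjStarAlgEquiv (creator j) = creator (j + 1) := by
  ext1 x
  have h : ⟪stdBasis none, shiftUnitary.symm x⟫_ℂ = ⟪stdBasis none, x⟫_ℂ := by
    rw [← shiftUnitary.inner_map_map, shiftUnitary_vacuum, LinearIsometryEquiv.apply_symm_apply]
  simp [creator, InnerProductSpace.rankOne_apply, shiftUnitary_some, h]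

theorem conj_mem {x : Fock →L[ℂ] Fock} (hx : x ∈ boole) :
    shiftUnitary.conjStarAlgEquiv x ∈ boole := by
  have hc : Continuous fun x : Fock →L[ℂ] Fock => shiftUnitary.conjStarAlgEquiv x := by
    simp only [LinearIsometryEquiv.conjStarAlgEquiv_apply]
    fun_prop
  refine closure_minimal (s := (StarAlgebra.adjoin ℂ (Set.range creator) : Set (Fock →L[ℂ] Fock)))
    (t := (fun x => shiftUnitary.conjStarAlgEquiv x) ⁻¹' (boole : Set (Fock →L[ℂ] Fock)))
    ?_ (isClosed_boole.preimage hc) hx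
  intro y hy
  induction hy using StarAlgebra.adjoin_induction with
  | mem y h =>
    obtain ⟨j, rfl⟩ := h
    simp only [Set.mem_preimage, conj_creator]
    exact creator_mem _
  | algebraMap r =>
    simp only [Set.mem_preimage, SetLike.mem_coe]
    rw [Algebra.algebraMap_eq_smul_one, _root_.map_smul, map_one]
    exact boole.smul_mem (one_mem _) r
  | add y z _ _ hy hz =>
    simp only [Set.mem_preimage, SetLike.mem_coe, map_add] at *
    exact add_mem hy hz
  | mul y z _ _ hy hz =>
    simp only [Set.mem_preimage, SetLike.mem_coe, map_mul] at *
    exact mul_mem hy hz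
  | star y _ hy =>
    simp only [Set.mem_preimage, SetLike.mem_coe, map_star] at *
    exact star_mem hy

/-- The shift `s` of the boolean algebra: the restriction of `Ad_V`. -/
def shift : boole →⋆ₐ[ℂ] boole :=
  StarAlgHom.codRestrict
    (((shiftUnitary.conjStarAlgEquiv : (Fock →L[ℂ] Fock) ≃⋆ₐ[ℂ] (Fock →L[ℂ] Fock)) :
      (Fock →L[ℂ] Fock) →⋆ₐ[ℂ] (Fock →L[ℂ] Fock)).comp boole.subtype)
    boole fun x => conj_mem x.2

theorem coe_shift (x : boole) :
    (shift x : Fock →L[ℂ] Fock) = shiftUnitary.conjStarAlgEquiv (x : Fock →L[ℂ] Fock) := rfl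

theorem shift_creator (j : ℤ) : shift ⟨creator j, creator_mem j⟩ = ⟨creator (j + 1), creator_mem _⟩ :=
  Subtype.ext (conj_creator j)

theorem continuous_shift : Continuous shift := by
  refine Continuous.subtype_mk (f := fun x : boole =>
    shiftUnitary.conjStarAlgEquiv (x : Fock →L[ℂ] Fock)) ?_ _
  simp only [LinearIsometryEquiv.conjStarAlgEquiv_apply]
  fun_prop

/-- The orthogonal projection `P` onto the line of the vacuum vector. -/
def vacuumProjOp : Fock →L[ℂ] Fock :=
  InnerProductSpace.rankOne ℂ (stdBasis none) (stdBasis none)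

theorem vacuumProjOp_mem : vacuumProjOp ∈ boole := by
  have h : vacuumProjOp = star (creator 0) * creator 0 := by
    ext1 x
    simp [vacuumProjOp, creator, ContinuousLinearMap.star_eq_adjoint,
      InnerProductSpace.rankOne_apply, stdBasis.orthonormal.1]
  rw [h]
  exact mul_mem (star_mem (creator_mem 0)) (creator_mem 0)

/-- The projection `P` as an element of the boolean algebra. -/
def vacuumProj : boole := ⟨vacuumProjOp, vacuumProjOp_mem⟩

theorem isCompactOperator_rankOne (x y : Fock) :
    IsCompactOperator (InnerProductSpace.rankOne ℂ x y : Fock →L[ℂ] Fock) := by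
  have h : IsCompactOperator (innerSL ℂ y : Fock →L[ℂ] ℂ) :=
    isCompactOperator_of_locallyCompactSpace_dom _
  rw [InnerProductSpace.rankOne_def']
  exact h.clm_comp (ContinuousLinearMap.toSpanSingleton ℂ x)

theorem isClosed_compact_add_scalar :
    IsClosed {x : Fock →L[ℂ] Fock | ∃ b : ℂ, IsCompactOperator (x - b • (1 : Fock →L[ℂ] Fock))} := by
  have hK : IsClosed (compactOperator (RingHom.id ℂ) Fock Fock : Set (Fock →L[ℂ] Fock)) :=
    isClosed_setOfPred_isCompactOperator
  have h := Submodule.isClosed_sup_finiteDimensional _ (Submodule.span ℂ {(1 : Fock →L[ℂ] Fock)}) hK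
  convert h using 1
  ext x
  simp only [Set.mem_ofPred_eq, SetLike.mem_coe, Submodule.mem_sup, Submodule.mem_span_singleton]
  constructor
  · rintro ⟨b, hb⟩
    exact ⟨_, hb, _, ⟨b, rfl⟩, sub_add_cancel _ _⟩
  · rintro ⟨y, hy, _, ⟨b, rfl⟩, rfl⟩
    refine ⟨b, ?_⟩
    rw [add_sub_cancel_right]
    exact hy

theorem adjoin_creator_compact_add_scalar {x : Fock →L[ℂ] Fock}
    (hx : x ∈ StarAlgebra.adjoin ℂ (Set.range creator)) :
    ∃ (b : ℂ) (k : Fock →L[ℂ] Fock), x = k + b • (1 : Fock →L[ℂ] Fock) ∧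
      IsCompactOperator k ∧ IsCompactOperator (star k : Fock →L[ℂ] Fock) := by
  induction hx using StarAlgebra.adjoin_induction with
  | mem x h =>
    obtain ⟨j, rfl⟩ := h
    refine ⟨0, creator j, by simp, isCompactOperator_rankOne _ _, ?_⟩
    rw [ContinuousLinearMap.star_eq_adjoint, creator, InnerProductSpace.adjoint_rankOne]
    exact isCompactOperator_rankOne _ _
  | algebraMap r =>
    exact ⟨r, 0, by rw [zero_add, Algebra.algebraMap_eq_smul_one], isCompactOperator_zero,
      by rw [star_zero]; exact isCompactOperator_zero⟩
  | add x y _ _ hx hy =>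
    obtain ⟨b, k, rfl, hk, hk'⟩ := hx
    obtain ⟨c, l, rfl, hl, hl'⟩ := hy
    refine ⟨b + c, k + l, by rw [add_smul]; abel, hk.add hl, ?_⟩
    rw [star_add]
    exact hk'.add hl'
  | mul x y _ _ hx hy =>
    obtain ⟨b, k, rfl, hk, hk'⟩ := hx
    obtain ⟨c, l, rfl, hl, hl'⟩ := hy
    refine ⟨b * c, k * l + c • k + b • l, ?_, ?_, ?_⟩
    · simp only [add_mul, mul_add, smul_mul_assoc, mul_smul_comm, mul_one, one_mul, mul_smul]
      rw [smul_add, smul_comm b c]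
      abel
    · exact ((hk.comp_clm l).add (hk.smul c)).add (hl.smul b)
    · simp only [star_add, star_mul, star_smul]
      exact ((hl'.comp_clm (star k)).add (hk'.smul (star c))).add (hl'.smul (star b))
  | star x _ hx =>
    obtain ⟨b, k, rfl, hk, hk'⟩ := hx
    exact ⟨star b, star k, by simp, hk', by rwa [star_star]⟩

/-- Every element of the boolean algebra is the sum of a compact operator and of a scalar. -/
theorem exists_isCompactOperator_sub (x : boole) :
    ∃ b : ℂ, IsCompactOperator ((x : Fock →L[ℂ] Fock) - b • (1 : Fock →L[ℂ] Fock)) := by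
  refine closure_minimal (fun y hy => ?_) isClosed_compact_add_scalar x.2
  obtain ⟨b, k, rfl, hk, -⟩ := adjoin_creator_compact_add_scalar hy
  refine ⟨b, ?_⟩
  rw [add_sub_cancel_right]
  exact hk

theorem not_isCompactOperator_one : ¬ IsCompactOperator (1 : Fock →L[ℂ] Fock) := by
  intro h
  have hfin : FiniteDimensional ℂ Fock := FiniteDimensional.of_isCompactOperator_id h
  have := (stdBasis.orthonormal.linearIndependent).finite
  exact not_finite (Option ℤ)

/-- The scalar part `b` of an element `x = A + bI`, with `A` compact, of the boolean algebra. -/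
def scalarPart (x : boole) : ℂ := (exists_isCompactOperator_sub x).choose

/-- The scalar part is the only possible one. -/
theorem scalarPart_eq (x : boole) (b : ℂ)
    (h : IsCompactOperator ((x : Fock →L[ℂ] Fock) - b • (1 : Fock →L[ℂ] Fock))) : scalarPart x = b := by
  by_contra hne
  have hd := (h.sub (exists_isCompactOperator_sub x).choose_spec).smul (scalarPart x - b)⁻¹
  apply not_isCompactOperator_one
  have h1 : (scalarPart x - b)⁻¹ * (scalarPart x - b) = 1 := inv_mul_cancel₀ (sub_ne_zero.mpr hne)
  have h2 : ((1 : Fock →L[ℂ] Fock) : Fock → Fock) = (scalarPart x - b)⁻¹ •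
      (⇑((x : Fock →L[ℂ] Fock) - b • (1 : Fock →L[ℂ] Fock)) -
        ⇑((x : Fock →L[ℂ] Fock) - scalarPart x • (1 : Fock →L[ℂ] Fock))) := by
    funext v
    change v = (scalarPart x - b)⁻¹ • (((x : Fock →L[ℂ] Fock) v - b • v)
      - ((x : Fock →L[ℂ] Fock) v - scalarPart x • v))
    rw [sub_sub_sub_cancel_left, ← sub_smul, smul_smul, h1, one_smul]
  rw [h2]
  exact hd

/-- The compact part `A` of an element `x = A + bI` of the boolean algebra. -/
def compactPart (x : boole) : Fock →L[ℂ] Fock := (x : Fock →L[ℂ] Fock) - scalarPart x • (1 : Fock →L[ℂ] Fock)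

theorem isCompactOperator_compactPart (x : boole) : IsCompactOperator (compactPart x) :=
  (exists_isCompactOperator_sub x).choose_spec

/-- The conditional expectation `A + bI ↦ (⟨A e_o, e_o⟩ + b) P + b (I - P)` of the boolean algebra
onto the fixed points of its shift. -/
def booleExpectation (x : boole) : boole :=
  (⟪stdBasis none, compactPart x (stdBasis none)⟫_ℂ + scalarPart x) • vacuumProj
    + scalarPart x • (1 - vacuumProj)

theorem booleExpectation_eq (x : boole) (k : Fock →L[ℂ] Fock) (b : ℂ) (hk : IsCompactOperator k)
    (hx : (x : Fock →L[ℂ] Fock) = k + b • (1 : Fock →L[ℂ] Fock)) :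
    booleExpectation x =
      (⟪stdBasis none, k (stdBasis none)⟫_ℂ + b) • vacuumProj + b • (1 - vacuumProj) := by
  have hb : scalarPart x = b := scalarPart_eq x b (by rw [hx, add_sub_cancel_right]; exact hk)
  have hc : compactPart x = k := by rw [compactPart, hb, hx, add_sub_cancel_right]
  rw [booleExpectation, hb, hc]

end Boolean

/-! ### The tensor product with a rotation -/

/-- The C⋆-algebra of the continuous functions from the circle to the boolean algebra. -/
abbrev Alg : Type := C(Circle, boole)

/-- The number `λ_l = exp(2πi l θ)`. -/
def eigval (θ : ℝ) (l : ℤ) : Circle := Circle.exp (2 * Real.pi * l * θ)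

/-- The endomorphism `α(f)(z) = s(f(exp(2πi θ) z))`. -/
def alpha (θ : ℝ) : Endo Alg where
  toFun f := ⟨fun z => shift (f (Circle.exp (2 * Real.pi * θ) * z)),
    continuous_shift.comp (f.continuous.comp (continuous_const.mul continuous_id))⟩
  map_one' := by ext1 z; exact map_one shift
  map_mul' f g := by ext1 z; exact map_mul shift _ _
  map_zero' := by ext1 z; exact map_zero shift
  map_add' f g := by ext1 z; exact map_add shift _ _
  commutes' r := by ext1 z; exact AlgHomClass.commutes shift r
  map_star' f := by ext1 z; exact map_star shift _

/-- The contour integral `∮ g(z) dz` over the unit circle, counterclockwise. -/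
def contourIntegral (g : Circle → boole) : boole :=
  ∫ t in (0 : ℝ)..(2 * Real.pi), (Complex.I * (Circle.exp t : ℂ)) • g (Circle.exp t)

/-- `E₁(f) = ∮ ℰ₁(f(z)) dz / (2πi z)`, as a constant function. -/
def expectation (f : Alg) : Alg :=
  ContinuousMap.const Circle
    (contourIntegral fun z => (2 * Real.pi * Complex.I * (z : ℂ))⁻¹ • booleExpectation (f z))

/-- The coefficient `∮ ℰ₁(f(z)) dz / (2πi z^{l+1})`. -/
def coefficient (l : ℤ) (f : Alg) : boole :=
  contourIntegral fun z =>
    (2 * Real.pi * Complex.I * (z : ℂ) ^ (l + 1))⁻¹ • booleExpectation (f z)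

theorem continuous_circle_coe : Continuous fun z : Circle => (z : ℂ) := by fun_prop

/-- The function `u_l(z) = z^l I`. -/
def u (l : ℤ) : Alg :=
  ⟨fun z => ((z ^ l : Circle) : ℂ) • (1 : boole),
    ((continuous_circle_coe.comp (continuous_zpow l)).smul continuous_const)⟩

end

end BooleanRotation

open BooleanRotation

namespace BooleanRotation

noncomputable section

/-! ### Weighted ergodic averages and their limits -/

section Averages

variable {A : Type*} [CStarAlgebra A] (Φ : Endo A) (lam : Circle)

/-! Everything follows from norm convergence of the weighted averages `cesaro`. These are
contractive for every unimodular weight, so convergence to a prescribed bounded linear map need only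
be checked on a set with dense span (`tendsto_cesaro_of_mem_closure_span`). For `alpha` that set
consists of the monomials z ↦ z^m x with x in `boole`. Since `u m` is an eigenvector, weight λ on
such a monomial becomes weight λ/λ_m on x under the shift (`cesaro_u_mul_const`).

For the shift, `boole` is densely spanned by 1 and the matrix units. Both 1 and the vacuum
projection are fixed, so their averages are geometric. Any other matrix unit has, up to taking
adjoints, a row index running through distinct basis vectors; Pythagoras bounds the sum of n terms
by √n, so its averages vanish at every weight. Thus the limit is `booleExpectation` at weight 1 and
zero at other weights (`tendsto_cesaro_shift`). Irrationality makes the λ_m distinct, so at weight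
λ_l only the Fourier mode l survives.

The rest is soft. At weight 1, an invariant bounded functional χ satisfies χ = χ ∘ E, which gives
unique extensions. An eigenvector is the limit of its own averages, which identifies the fixed
points, the eigenspaces and the point spectrum. Averages that vanish on the algebra vanish by
density on every covariant GNS space, while the unitaries `u l` have nonzero GNS vectors; this
settles the full spectrum. -/

theorem norm_endo_apply_le (a : A) : ‖Φ a‖ ≤ ‖a‖ :=
  NonUnitalStarAlgHom.norm_apply_le Φ a

theorem continuous_endo : Continuous Φ :=
  AddMonoidHomClass.continuous_of_bound Φ 1 fun a => by
    rw [one_mul]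
    exact norm_endo_apply_le Φ a

theorem iterate_endo_add (k : ℕ) (a b : A) : Φ^[k] (a + b) = Φ^[k] a + Φ^[k] b :=
  iterate_map_add Φ k a b

theorem iterate_endo_mul (k : ℕ) (a b : A) : Φ^[k] (a * b) = Φ^[k] a * Φ^[k] b :=
  iterate_map_mul Φ k a b

theorem iterate_endo_smul (k : ℕ) (c : ℂ) (a : A) : Φ^[k] (c • a) = c • Φ^[k] a :=
  Function.Commute.iterate_left (f := Φ) (g := fun b => c • b) (fun b => map_smul Φ c b) k a

theorem norm_iterate_endo_le (k : ℕ) (a : A) : ‖Φ^[k] a‖ ≤ ‖a‖ := by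
  induction k with
  | zero => exact le_rfl
  | succ k ih =>
    rw [Function.iterate_succ_apply']
    exact (norm_endo_apply_le Φ _).trans ih

theorem cesaro_add (a b : A) (n : ℕ) :
    cesaro Φ lam (a + b) n = cesaro Φ lam a n + cesaro Φ lam b n := by
  simp only [cesaro, iterate_endo_add, smul_add, Finset.sum_add_distrib]

theorem cesaro_smul (c : ℂ) (a : A) (n : ℕ) :
    cesaro Φ lam (c • a) n = c • cesaro Φ lam a n := by
  simp only [cesaro, iterate_endo_smul, Finset.smul_sum]
  refine Finset.sum_congr rfl fun k _ => ?_
  simp only [smul_smul]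
  congr 1
  ring

theorem cesaro_sub (a b : A) (n : ℕ) :
    cesaro Φ lam (a - b) n = cesaro Φ lam a n - cesaro Φ lam b n := by
  rw [eq_sub_iff_add_eq, ← cesaro_add, sub_add_cancel]

/-- Stated for an arbitrary seminormed space because it serves both the algebra and the GNS spaces.
-/
theorem norm_average_le {E : Type*} [SeminormedAddCommGroup E] [NormedSpace ℂ E] (v : ℕ → E)
    {C : ℝ} (hC : 0 ≤ C) (hv : ∀ k, ‖v k‖ ≤ C) (n : ℕ) :
    ‖(n : ℂ)⁻¹ • ∑ k ∈ Finset.range n, ((lam : ℂ) ^ (-(k : ℤ))) • v k‖ ≤ C := by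
  have h1 : ‖∑ k ∈ Finset.range n, ((lam : ℂ) ^ (-(k : ℤ))) • v k‖ ≤ n * C := by
    refine (norm_sum_le _ _).trans ?_
    refine (Finset.sum_le_card_nsmul _ _ C fun k _ => ?_).trans (by simp)
    rw [norm_smul, norm_zpow, Circle.norm_coe, one_zpow, one_mul]
    exact hv k
  rw [norm_smul, norm_inv, Complex.norm_natCast]
  rcases Nat.eq_zero_or_pos n with rfl | hn
  · simpa using hC
  · rw [inv_mul_le_iff₀ (by exact_mod_cast hn)]
    exact h1

theorem norm_cesaro_le (a : A) (n : ℕ) : ‖cesaro Φ lam a n‖ ≤ ‖a‖ :=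
  norm_average_le lam _ (norm_nonneg a) (fun k => norm_iterate_endo_le Φ k a) n

variable {Φ lam} in
theorem iterate_of_mem_eigenspace {a : A} (ha : a ∈ eigenspace Φ lam) (k : ℕ) :
    Φ^[k] a = (lam : ℂ) ^ k • a := by
  have ha' : Φ a = (lam : ℂ) • a := Module.End.mem_eigenspace_iff.mp ha
  induction k with
  | zero => simp
  | succ k ih => rw [Function.iterate_succ_apply, ha', iterate_endo_smul, ih, smul_smul, pow_succ']

theorem average_eigenvector {E : Type*} [AddCommGroup E] [Module ℂ E] (v : E) {n : ℕ}
    (hn : n ≠ 0) :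
    (n : ℂ)⁻¹ • ∑ k ∈ Finset.range n, ((lam : ℂ) ^ (-(k : ℤ))) • ((lam : ℂ) ^ k • v) = v := by
  have h (k : ℕ) : ((lam : ℂ) ^ (-(k : ℤ))) • ((lam : ℂ) ^ k • v) = v := by
    rw [smul_smul, zpow_neg, zpow_natCast, inv_mul_cancel₀ (pow_ne_zero _ lam.coe_ne_zero),
      one_smul]
  simp only [h, Finset.sum_const, Finset.card_range]
  rw [← Nat.cast_smul_eq_nsmul ℂ, smul_smul, inv_mul_cancel₀ (by exact_mod_cast hn), one_smul]

variable {Φ lam} in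
theorem cesaro_of_mem_eigenspace {a : A} (ha : a ∈ eigenspace Φ lam) {n : ℕ} (hn : n ≠ 0) :
    cesaro Φ lam a n = a := by
  simp only [cesaro, iterate_of_mem_eigenspace ha]
  exact average_eigenvector lam a hn

variable {Φ lam} in
/-- The averages of an eigenvector converge to it. -/
theorem eq_of_mem_eigenspace {a b : A} (ha : a ∈ eigenspace Φ lam)
    (hb : Tendsto (cesaro Φ lam a) atTop (𝓝 b)) : a = b := by
  refine tendsto_nhds_unique (tendsto_const_nhds.congr' ?_) hb
  filter_upwards [eventually_ne_atTop 0] with n hn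
  exact (cesaro_of_mem_eigenspace ha hn).symm

theorem mem_fixedPoints_iff {a : A} : a ∈ fixedPoints Φ ↔ Φ a = a := Iff.rfl

theorem mem_fixedPoints_iff_mem_eigenspace {a : A} :
    a ∈ fixedPoints Φ ↔ a ∈ eigenspace Φ 1 := by
  rw [mem_fixedPoints_iff, eigenspace, Module.End.mem_eigenspace_iff, Circle.coe_one, one_smul]
  rfl

/-- Convergence of contractive averages is inherited by closures. -/
theorem tendsto_of_mem_closure {E F : Type*} [SeminormedAddCommGroup E] [SeminormedAddCommGroup F]
    (M : ℕ → E → F) (hsub : ∀ n a b, M n (a - b) = M n a - M n b) (hM : ∀ n a, ‖M n a‖ ≤ ‖a‖)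
    {L : E → F} (hL : Continuous L) {S : Set E}
    (hS : ∀ a ∈ S, Tendsto (fun n => M n a) atTop (𝓝 (L a))) {a : E} (ha : a ∈ closure S) :
    Tendsto (fun n => M n a) atTop (𝓝 (L a)) := by
  rw [Metric.tendsto_atTop]
  intro ε hε
  -- An ε/3 argument: `b` must be close enough to `a` both for continuity of `L` and for the
  -- contractions `M n`.
  obtain ⟨δ, hδ, hLδ⟩ := Metric.continuous_iff.mp hL a (ε / 3) (by positivity)
  obtain ⟨b, hb, hab⟩ := Metric.mem_closure_iff.mp ha (min δ (ε / 3)) (by positivity)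
  obtain ⟨N, hN⟩ := Metric.tendsto_atTop.mp (hS b hb) (ε / 3) (by positivity)
  refine ⟨N, fun n hn => ?_⟩
  have h1 : dist (M n a) (M n b) < ε / 3 := by
    rw [dist_eq_norm, ← hsub]
    exact ((hM n _).trans_eq (dist_eq_norm a b).symm).trans_lt (hab.trans_le (min_le_right _ _))
  have h2 : dist (L b) (L a) < ε / 3 :=
    hLδ b (by rw [dist_comm]; exact hab.trans_le (min_le_left _ _))
  have h3 := hN n hn
  have h4 := dist_triangle4 (M n a) (M n b) (L b) (L a)
  linarith

theorem tendsto_cesaro_of_mem_closure_span (L : A →L[ℂ] A) {S : Set A}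
    (hS : ∀ a ∈ S, Tendsto (cesaro Φ lam a) atTop (𝓝 (L a))) {a : A}
    (ha : a ∈ closure (Submodule.span ℂ S : Set A)) :
    Tendsto (cesaro Φ lam a) atTop (𝓝 (L a)) := by
  refine tendsto_of_mem_closure (fun n a => cesaro Φ lam a n)
    (fun n a b => cesaro_sub Φ lam a b n) (fun n a => norm_cesaro_le Φ lam a n) L.continuous
    (fun b hb => ?_) ha
  induction hb using Submodule.span_induction with
  | mem b hb => exact hS b hb
  | zero =>
    rw [map_zero]
    exact tendsto_const_nhds.congr fun n => by simpa using (cesaro_smul Φ lam 0 0 n).symm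
  | add b c _ _ hb hc =>
    rw [map_add]
    exact (hb.add hc).congr fun n => (cesaro_add Φ lam b c n).symm
  | smul r b _ hb =>
    rw [map_smul]
    exact (hb.const_smul r).congr fun n => (cesaro_smul Φ lam r b n).symm

theorem map_cesaro (a : A) (n : ℕ) : Φ (cesaro Φ lam a n) = cesaro Φ lam (Φ a) n := by
  simp only [cesaro, map_smul, map_sum, ← Function.iterate_succ_apply,
    ← Function.iterate_succ_apply']

theorem cesaro_one_eq (a : A) (n : ℕ) :
    cesaro Φ 1 a n = (n : ℂ)⁻¹ • ∑ k ∈ Finset.range n, Φ^[k] a := by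
  simp [cesaro]

theorem tendsto_inv_smul_of_bounded {E : Type*} [SeminormedAddCommGroup E] [NormedSpace ℂ E]
    (v : ℕ → E) (C : ℝ) (hv : ∀ n, ‖v n‖ ≤ C) :
    Tendsto (fun n : ℕ => (n : ℂ)⁻¹ • v n) atTop (𝓝 0) := by
  refine squeeze_zero_norm (a := fun n : ℕ => (n : ℝ)⁻¹ * C) (fun n => ?_) ?_
  · rw [norm_smul, norm_inv, Complex.norm_natCast]
    exact mul_le_mul_of_nonneg_left (hv n) (by positivity)
  · simpa using (tendsto_inv_atTop_nhds_zero_nat (𝕜 := ℝ)).mul_const C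

variable {Φ} {E : A → A}

/-- The difference of the two averages telescopes to `(Φ^n a - a)/n`, whose numerator stays bounded.
-/
theorem limit_invariant (hE : ∀ a, Tendsto (cesaro Φ 1 a) atTop (𝓝 (E a))) (a : A) :
    E (Φ a) = E a := by
  refine sub_eq_zero.mp (tendsto_nhds_unique ((hE (Φ a)).sub (hE a)) ?_)
  have h (n : ℕ) : cesaro Φ 1 (Φ a) n - cesaro Φ 1 a n = (n : ℂ)⁻¹ • (Φ^[n] a - a) := by
    rw [cesaro_one_eq, cesaro_one_eq, ← smul_sub]
    congr 1
    simp only [← Function.iterate_succ_apply]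
    rw [← Finset.sum_sub_distrib, Finset.sum_range_sub (fun k => Φ^[k] a)]
    rfl
  simp only [h]
  refine tendsto_inv_smul_of_bounded _ (‖a‖ + ‖a‖) fun n => ?_
  exact (norm_sub_le _ _).trans (add_le_add_left (norm_iterate_endo_le Φ n a) _)

/-- `Φ` is continuous and commutes with averaging, so `Φ (E a) = E (Φ a)`, and invariance of the
limit concludes. -/
theorem limit_mem (hE : ∀ a, Tendsto (cesaro Φ 1 a) atTop (𝓝 (E a))) (a : A) :
    E a ∈ fixedPoints Φ := by
  rw [mem_fixedPoints_iff, ← limit_invariant hE a]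
  refine tendsto_nhds_unique ?_ (hE (Φ a))
  have := ((continuous_endo Φ).tendsto _).comp (hE a)
  rw [limit_invariant hE a]
  refine this.congr fun n => ?_
  exact map_cesaro Φ 1 a n

theorem limit_fixes (hE : ∀ a, Tendsto (cesaro Φ 1 a) atTop (𝓝 (E a))) {a : A}
    (ha : a ∈ fixedPoints Φ) : E a = a :=
  (eq_of_mem_eigenspace ((mem_fixedPoints_iff_mem_eigenspace Φ).mp ha) (hE a)).symm

section Order

attribute [local instance] CStarAlgebra.spectralOrder CStarAlgebra.spectralOrderedRing

theorem cesaro_one_nonneg (a : A) (n : ℕ) : 0 ≤ cesaro Φ 1 (star a * a) n := by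
  have h : cesaro Φ 1 (star a * a) n =
      (n : ℝ)⁻¹ • ∑ k ∈ Finset.range n, star (Φ^[k] a) * Φ^[k] a := by
    rw [cesaro_one_eq, ← Complex.coe_smul, Complex.ofReal_inv, Complex.ofReal_natCast]
    congr 1
    refine Finset.sum_congr rfl fun k _ => ?_
    rw [iterate_endo_mul, Function.Commute.iterate_left (f := Φ) (g := star) (fun b => map_star Φ b)]
  rw [h]
  exact smul_nonneg (by positivity) (Finset.sum_nonneg fun k _ => star_mul_self_nonneg _)

/-- The square root of a positive fixed point is a fixed point. -/
theorem limit_positive (hE : ∀ a, Tendsto (cesaro Φ 1 a) atTop (𝓝 (E a))) (a : A) :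
    ∃ c ∈ fixedPoints Φ, E (star a * a) = star c * c := by
  have h0 : 0 ≤ E (star a * a) :=
    ge_of_tendsto' (hE _) fun n => cesaro_one_nonneg a n
  have hs := CFC.sqrt_nonneg (E (star a * a))
  have hm := CFC.sqrt_mul_sqrt_self (E (star a * a)) h0
  have hΦ : 0 ≤ Φ (CFC.sqrt (E (star a * a))) := map_nonneg Φ hs
  refine ⟨CFC.sqrt (E (star a * a)), ?_, ?_⟩
  · rw [mem_fixedPoints_iff]
    -- The image of the root is again a positive root of the same fixed element; positive roots are
    -- unique.
    refine (CFC.sqrt_unique ?_ hΦ).symm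
    rw [← map_mul, hm]
    exact limit_mem hE _
  · rw [(IsSelfAdjoint.of_nonneg hs).star_eq, hm]

end Order

open scoped ComplexOrder in
-- Boundedness is not part of `State`; it is automatic for functionals that are positive for the
-- spectral order.
theorem State.exists_norm_apply_le (φ : State A) : ∃ C : ℝ, ∀ a, ‖φ.toLinearMap a‖ ≤ C * ‖a‖ := by
  let _ := CStarAlgebra.spectralOrder A
  let _ := CStarAlgebra.spectralOrderedRing A
  obtain ⟨C, hC⟩ := PositiveLinearMap.exists_norm_apply_le φ.toPositive
  exact ⟨C, hC⟩

theorem State.continuous (φ : State A) : Continuous φ.toLinearMap := by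
  obtain ⟨C, hC⟩ := φ.exists_norm_apply_le
  exact AddMonoidHomClass.continuous_of_bound φ.toLinearMap C hC

theorem limit_isConditionalExpectation (hE : ∀ a, Tendsto (cesaro Φ 1 a) atTop (𝓝 (E a))) :
    IsConditionalExpectation (fixedPoints Φ) E where
  map_add a b := tendsto_nhds_unique (hE (a + b))
    (((hE a).add (hE b)).congr fun n => (cesaro_add Φ 1 a b n).symm)
  map_smul c a := tendsto_nhds_unique (hE (c • a))
    (((hE a).const_smul c).congr fun n => (cesaro_smul Φ 1 c a n).symm)
  mem := limit_mem hE
  fixes a ha := limit_fixes hE ha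
  norm_le a := le_of_tendsto' (hE a).norm fun n => norm_cesaro_le Φ 1 a n
  positive a := (limit_positive hE a).imp fun _ h => h.2
  bimodule b hb c hc a := by
    refine tendsto_nhds_unique (hE (b * a * c))
      (((hE a).const_mul b).mul_const c |>.congr fun n => ?_)
    have hbk (k : ℕ) : Φ^[k] b = b := Function.iterate_fixed hb k
    have hck (k : ℕ) : Φ^[k] c = c := Function.iterate_fixed hc k
    simp only [cesaro_one_eq, iterate_endo_mul, hbk, hck, mul_smul_comm, smul_mul_assoc,
      Finset.mul_sum, Finset.sum_mul]

/-- An invariant functional, applied to the averages, is constant. -/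
theorem invariant_functional_cesaro (χ : A →ₗ[ℂ] ℂ) (hχ : ∀ a, χ (Φ a) = χ a) (a : A) {n : ℕ}
    (hn : n ≠ 0) : χ (cesaro Φ 1 a n) = χ a := by
  have hk (k : ℕ) : χ (Φ^[k] a) = χ a := by
    induction k with
    | zero => rfl
    | succ k ih => rw [Function.iterate_succ_apply', hχ, ih]
  rw [cesaro_one_eq, map_smul, map_sum]
  simp only [hk, Finset.sum_const, Finset.card_range, nsmul_eq_mul, smul_eq_mul]
  exact inv_mul_cancel_left₀ (by exact_mod_cast hn) _

/-- This is the uniqueness half of unique ergodicity: an invariant functional is determined by its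
restriction to the fixed points. -/
theorem invariant_functional_limit (hE : ∀ a, Tendsto (cesaro Φ 1 a) atTop (𝓝 (E a)))
    (χ : A →ₗ[ℂ] ℂ) (hc : Continuous χ) (hχ : ∀ a, χ (Φ a) = χ a) (a : A) : χ (E a) = χ a := by
  refine tendsto_nhds_unique ((hc.tendsto _).comp (hE a)) (tendsto_const_nhds.congr' ?_)
  filter_upwards [eventually_ne_atTop 0] with n hn
  exact (invariant_functional_cesaro χ hχ a hn).symm

/-- The limit of the averages, as a linear map with values in the fixed-point subalgebra. -/
def limitMap (hE : ∀ a, Tendsto (cesaro Φ 1 a) atTop (𝓝 (E a))) : A →ₗ[ℂ] fixedPoints Φ where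
  toFun a := ⟨E a, limit_mem hE a⟩
  map_add' a b := Subtype.ext ((limit_isConditionalExpectation hE).map_add a b)
  map_smul' c a := Subtype.ext ((limit_isConditionalExpectation hE).map_smul c a)

theorem limitMap_coe (hE : ∀ a, Tendsto (cesaro Φ 1 a) atTop (𝓝 (E a))) (a : fixedPoints Φ) :
    limitMap hE a = a :=
  Subtype.ext (limit_fixes hE a.2)

theorem limitMap_map (hE : ∀ a, Tendsto (cesaro Φ 1 a) atTop (𝓝 (E a))) (a : A) :
    limitMap hE (Φ a) = limitMap hE a :=
  Subtype.ext (limit_invariant hE a)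

/-- The invariant state extending a state of the fixed-point subalgebra. -/
def limitState (hE : ∀ a, Tendsto (cesaro Φ 1 a) atTop (𝓝 (E a))) (ψ : State (fixedPoints Φ)) :
    State A where
  toLinearMap := ψ.toLinearMap ∘ₗ limitMap hE
  nonneg a := by
    obtain ⟨c, hc, h⟩ := limit_positive hE a
    have : limitMap hE (star a * a) = star (⟨c, hc⟩ : fixedPoints Φ) * ⟨c, hc⟩ := Subtype.ext h
    rw [LinearMap.comp_apply, this]
    exact ψ.nonneg _
  map_one := by
    rw [LinearMap.comp_apply, show limitMap hE 1 = 1 from limitMap_coe hE 1]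
    exact ψ.map_one

open scoped ComplexOrder in
-- The invariant state is `ψ ∘ E`: restrict `ψ` to the fixed points, then extend by `limitState`.
theorem exists_invariant_state (hE : ∀ a, Tendsto (cesaro Φ 1 a) atTop (𝓝 (E a))) (ψ : A →ₗ[ℂ] ℂ)
    (hψ : ∀ a, 0 ≤ ψ (star a * a)) (h1 : ψ 1 = 1) : ∃ φ : State A, φ.IsInvariant Φ :=
  ⟨limitState hE ⟨ψ ∘ₗ (fixedPoints Φ).subtype.toLinearMap, fun a => hψ a, h1⟩,
    fun a => congrArg (fun b : fixedPoints Φ => ψ b) (limitMap_map hE a)⟩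

theorem State.ext_toLinearMap {B : Type*} [Ring B] [StarRing B] [Algebra ℂ B] {φ ψ : State B}
    (h : ∀ a, φ.toLinearMap a = ψ.toLinearMap a) : φ = ψ := by
  cases φ
  cases ψ
  congr
  exact LinearMap.ext h

/-- Norm convergence of the averages implies unique ergodicity. -/
theorem isUniquelyErgodicWithExpectation_of_tendsto
    (hE : ∀ a, Tendsto (cesaro Φ 1 a) atTop (𝓝 (E a))) :
    IsUniquelyErgodicWithExpectation Φ E where
  functional_extension ψ := by
    refine ⟨ψ.comp ((limitMap hE).mkContinuous 1 fun a => ?_), ⟨fun a => ?_, fun a => ?_⟩, ?_⟩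
    · rw [one_mul]
      exact (limit_isConditionalExpectation hE).norm_le a
    · exact congrArg ψ (limitMap_map hE a)
    · exact congrArg ψ (limitMap_coe hE a)
    · rintro χ ⟨hχ, hψ⟩
      ext a
      exact (invariant_functional_limit hE χ.toLinearMap χ.continuous hχ a).symm.trans
        (hψ (limitMap hE a))
  state_extension ψ := by
    refine ⟨limitState hE ψ, ⟨fun a => ?_, fun a => ?_⟩, ?_⟩
    · exact congrArg ψ.toLinearMap (limitMap_map hE a)
    · exact congrArg ψ.toLinearMap (limitMap_coe hE a)
    · rintro χ ⟨hχ, hψ⟩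
      refine State.ext_toLinearMap fun a => ?_
      rw [← invariant_functional_limit hE χ.toLinearMap χ.continuous hχ a]
      exact hψ (limitMap hE a)
  expectation := limit_isConditionalExpectation hE
  invariant := limit_invariant hE
  tendsto := hE

end Averages

/-! ### Eigenvalues in covariant GNS representations -/

section Covariant

attribute [local instance] CStarAlgebra.spectralOrder CStarAlgebra.spectralOrderedRing

variable {A : Type*} [CStarAlgebra A] {Φ : Endo A} {lam : Circle} (φ : State A)

/-- The vector `π(a)ξ` of the GNS space. -/
def State.gnsVector : A →ₗ[ℂ] φ.GNS :=
  (UniformSpace.Completion.toComplL : φ.toPositive.PreGNS →L[ℂ] φ.GNS).toLinearMap ∘ₗ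
    φ.toPositive.toPreGNS.toLinearMap

theorem State.norm_gnsVector_sq (a : A) :
    ((‖φ.gnsVector a‖ ^ 2 : ℝ) : ℂ) = φ.toLinearMap (star a * a) := by
  have h : ‖φ.gnsVector a‖ = ‖φ.toPositive.toPreGNS a‖ := UniformSpace.Completion.norm_coe _
  rw [h, Complex.ofReal_pow]
  exact φ.toPositive.preGNS_norm_sq (φ.toPositive.toPreGNS a)

/-- The squared GNS norm is `φ(a⋆a)`, and `φ` is continuous. -/
theorem State.tendsto_gnsVector_zero {a : ℕ → A} (ha : Tendsto a atTop (𝓝 0)) :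
    Tendsto (fun n => φ.gnsVector (a n)) atTop (𝓝 0) := by
  have h1 : Tendsto (fun n => φ.toLinearMap (star (a n) * a n)) atTop (𝓝 0) := by
    have := (φ.continuous.tendsto _).comp (ha.star.mul ha)
    rwa [star_zero, zero_mul, map_zero] at this
  have h2 : Tendsto (fun n => ‖φ.gnsVector (a n)‖ ^ 2) atTop (𝓝 0) := by
    have := (Complex.continuous_re.tendsto _).comp h1
    refine (this.congr fun n => ?_)
    rw [Function.comp_apply, ← State.norm_gnsVector_sq, Complex.ofReal_re]
  rw [tendsto_zero_iff_norm_tendsto_zero]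
  have h3 := (Real.continuous_sqrt.tendsto _).comp h2
  rw [Real.sqrt_zero] at h3
  exact h3.congr fun n => Real.sqrt_sq (norm_nonneg _)

theorem State.covariantIsometry_gnsVector (h : φ.IsInvariant Φ) (a : A) :
    φ.covariantIsometry Φ h (φ.gnsVector a) = φ.gnsVector (Φ a) :=
  φ.covariantIsometry_coe Φ h a

theorem State.iterate_covariantIsometry_gnsVector (h : φ.IsInvariant Φ) (k : ℕ) (a : A) :
    (φ.covariantIsometry Φ h)^[k] (φ.gnsVector a) = φ.gnsVector (Φ^[k] a) := by
  induction k generalizing a with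
  | zero => rfl
  | succ k ih =>
    rw [Function.iterate_succ_apply, State.covariantIsometry_gnsVector, ih,
      Function.iterate_succ_apply]

theorem State.denseRange_gnsVector : DenseRange φ.gnsVector :=
  UniformSpace.Completion.denseRange_coe.comp
    φ.toPositive.toPreGNS.surjective.denseRange (UniformSpace.Completion.continuous_coe _)

/-- Invariance gives equal norms on the dense set of vectors `π(a)ξ`; the closed inequality passes
to the completion. -/
theorem State.norm_covariantIsometry_le (h : φ.IsInvariant Φ) (v : φ.GNS) :
    ‖φ.covariantIsometry Φ h v‖ ≤ ‖v‖ := by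
  refine φ.denseRange_gnsVector.induction_on v ?_ fun a => ?_
  · exact isClosed_le (by fun_prop) (by fun_prop)
  · rw [State.covariantIsometry_gnsVector, ← sq_le_sq₀ (norm_nonneg _) (norm_nonneg _)]
    apply le_of_eq
    apply Complex.ofReal_injective
    rw [State.norm_gnsVector_sq, State.norm_gnsVector_sq, ← map_star, ← map_mul, h]

theorem State.norm_iterate_covariantIsometry_le (h : φ.IsInvariant Φ) (k : ℕ) (v : φ.GNS) :
    ‖(φ.covariantIsometry Φ h)^[k] v‖ ≤ ‖v‖ := by
  induction k with
  | zero => exact le_rfl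
  | succ k ih =>
    rw [Function.iterate_succ_apply']
    exact (φ.norm_covariantIsometry_le h _).trans ih

/-- If all averages with weight `lam` vanish in the limit, then `lam` is not an eigenvalue of the
covariant GNS isometry of an invariant state. -/
theorem notMem_fullPurePointSpectrum_of_tendsto
    (hlim : ∀ a, Tendsto (cesaro Φ lam a) atTop (𝓝 0)) : lam ∉ fullPurePointSpectrum Φ := by
  rintro ⟨φ, h, hlam⟩
  obtain ⟨v, hv⟩ := hlam.exists_hasEigenvector
  apply hv.2
  let V := φ.covariantIsometry Φ h
  let M : ℕ → φ.GNS → φ.GNS := fun n w =>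
    (n : ℂ)⁻¹ • ∑ k ∈ Finset.range n, ((lam : ℂ) ^ (-(k : ℤ))) • V^[k] w
  have hVv : V v = (lam : ℂ) • v := hv.apply_eq_smul
  have hVk (k : ℕ) : V^[k] v = (lam : ℂ) ^ k • v := by
    induction k with
    | zero => simp
    | succ k ih =>
      rw [Function.iterate_succ_apply', ih, map_smul, hVv, smul_smul, pow_succ]
  have hM : Tendsto (fun n => M n v) atTop (𝓝 0) := by
    -- On the dense vectors `π(a)ξ` the Hilbert space averages are the images of `cesaro`, which
    -- tend to zero.
    refine tendsto_of_mem_closure M (fun n a b => ?_) (fun n a => ?_) (L := fun _ => 0)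
      continuous_const (S := Set.range φ.gnsVector) ?_ (φ.denseRange_gnsVector v)
    · simp only [M, iterate_map_sub, smul_sub, Finset.sum_sub_distrib]
    · exact norm_average_le lam _ (norm_nonneg a)
        (fun k => φ.norm_iterate_covariantIsometry_le h k a) n
    · rintro _ ⟨a, rfl⟩
      refine (φ.tendsto_gnsVector_zero (hlim a)).congr fun n => ?_
      simp only [M, V, State.iterate_covariantIsometry_gnsVector, cesaro, map_smul, map_sum]
  refine tendsto_nhds_unique (tendsto_const_nhds.congr' ?_) hM
  filter_upwards [eventually_ne_atTop 0] with n hn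
  simp only [M, hVk]
  exact (average_eigenvector lam v hn).symm

/-- An eigenvector of the endomorphism which does not vanish in the GNS representation of an
invariant state gives an eigenvector of the covariant isometry. -/
theorem mem_fullPurePointSpectrum_of_mem_eigenspace (h : φ.IsInvariant Φ) {a : A}
    (ha : a ∈ eigenspace Φ lam) (h0 : φ.toLinearMap (star a * a) ≠ 0) :
    lam ∈ fullPurePointSpectrum Φ := by
  refine ⟨φ, h, Module.End.hasEigenvalue_of_hasEigenvector (x := φ.gnsVector a) ⟨?_, fun h1 => h0 ?_⟩⟩
  · rw [Module.End.mem_eigenspace_iff]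
    have ha' : Φ a = (lam : ℂ) • a := Module.End.mem_eigenspace_iff.mp ha
    refine (φ.covariantIsometry_gnsVector h a).trans ?_
    rw [ha', map_smul]
  · rw [← State.norm_gnsVector_sq, h1]
    simp

end Covariant

/-! ### Averages of eigenvectors and of adjoints -/

section GeometricAverages

variable {A : Type*} [CStarAlgebra A] {Φ : Endo A} {lam mu : Circle}

theorem tendsto_cesaro_of_mem_eigenspace {a : A} (ha : a ∈ eigenspace Φ lam) :
    Tendsto (cesaro Φ lam a) atTop (𝓝 a) := by
  refine tendsto_const_nhds.congr' ?_
  filter_upwards [eventually_ne_atTop 0] with n hn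
  exact (cesaro_of_mem_eigenspace ha hn).symm

/-- The sum is geometric with ratio `q = mu / lam ≠ 1`, hence bounded by `2 / ‖q - 1‖ * ‖a‖`
uniformly in `n`. -/
theorem tendsto_cesaro_of_mem_eigenspace_of_ne {a : A} (ha : a ∈ eigenspace Φ mu) (h : lam ≠ mu) :
    Tendsto (cesaro Φ lam a) atTop (𝓝 0) := by
  have hne : ((mu / lam : Circle) : ℂ) ≠ 1 := by
    rw [Ne, Circle.coe_eq_one, div_eq_one]
    exact h.symm
  have hs (n : ℕ) : cesaro Φ lam a n = (n : ℂ)⁻¹ •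
      (((((mu / lam : Circle) : ℂ) ^ n - 1) / (((mu / lam : Circle) : ℂ) - 1)) • a) := by
    rw [← geom_sum_eq hne, cesaro, Finset.sum_smul]
    congr 1
    refine Finset.sum_congr rfl fun k _ => ?_
    rw [iterate_of_mem_eigenspace ha, smul_smul, Circle.coe_div, div_pow, zpow_neg, zpow_natCast,
      div_eq_inv_mul]
  simp only [funext hs]
  refine tendsto_inv_smul_of_bounded _ (2 / ‖((mu / lam : Circle) : ℂ) - 1‖ * ‖a‖) fun n => ?_
  rw [norm_smul, norm_div]
  gcongr
  refine (norm_sub_le _ _).trans_eq ?_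
  rw [norm_pow, Circle.norm_coe, one_pow, norm_one]
  norm_num

theorem star_cesaro (a : A) (n : ℕ) : star (cesaro Φ lam a n) = cesaro Φ lam⁻¹ (star a) n := by
  have h (k : ℕ) : star (Φ^[k] a) = Φ^[k] (star a) :=
    (Function.Commute.iterate_left (f := Φ) (g := star) (fun b => map_star Φ b) k a).symm
  simp only [cesaro, star_smul, star_sum, h, star_inv₀, star_natCast, star_zpow₀, Circle.coe_inv_eq_conj]
  rfl

end GeometricAverages

/-! ### The scalar part and the vacuum functional -/

open scoped InnerProductSpace

theorem norm_stdBasis (i : Option ℤ) : ‖stdBasis i‖ = 1 := stdBasis.orthonormal.1 i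

theorem inner_stdBasis (i j : Option ℤ) : ⟪stdBasis i, stdBasis j⟫_ℂ = if i = j then 1 else 0 :=
  orthonormal_iff_ite.mp stdBasis.orthonormal i j

/-- The basis vectors converge weakly to zero. -/
theorem tendsto_inner_stdBasis (v : Fock) :
    Tendsto (fun n : ℕ => ⟪v, stdBasis (some (n : ℤ))⟫_ℂ) atTop (𝓝 0) := by
  have h1 : Summable fun i : Option ℤ => ‖⟪stdBasis i, v⟫_ℂ‖ ^ 2 :=
    stdBasis.orthonormal.inner_products_summable v
  have hinj : Function.Injective fun n : ℕ => (some (n : ℤ) : Option ℤ) :=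
    (Option.some_injective _).comp Nat.cast_injective
  have h2 := (h1.comp_injective hinj).tendsto_atTop_zero
  rw [tendsto_zero_iff_norm_tendsto_zero]
  have h3 := (Real.continuous_sqrt.tendsto _).comp h2
  rw [Real.sqrt_zero] at h3
  refine h3.congr fun n => ?_
  rw [norm_inner_symm]
  exact Real.sqrt_sq (norm_nonneg _)

/-- A compact operator maps the basis vectors to a null sequence. -/
theorem tendsto_compact_apply_stdBasis {k : Fock →L[ℂ] Fock} (hk : IsCompactOperator k) :
    Tendsto (fun n : ℕ => k (stdBasis (some (n : ℤ)))) atTop (𝓝 0) := by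
  obtain ⟨K, hK, hsub⟩ := hk.image_subset_compact_of_bounded (f := (k : Fock →ₗ[ℂ] Fock))
    (Metric.isBounded_closedBall (x := (0 : Fock)) (r := 1))
  -- All the images lie in the compact set `K`, so it is enough that 0 is the only possible cluster
  -- point.
  refine hK.tendsto_nhds_of_unique_mapClusterPt (Eventually.of_forall fun n => ?_) ?_
  · exact hsub ⟨_, by simp [norm_stdBasis], rfl⟩
  · intro y _ hy
    -- Moving `k` to the other side as its adjoint, weak nullity of the basis vectors makes the
    -- inner products with `w` tend to 0.
    have hz (w : Fock) : ⟪w, y⟫_ℂ = 0 := by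
      have h1 : MapClusterPt ⟪w, y⟫_ℂ atTop
          ((fun z => ⟪w, z⟫_ℂ) ∘ fun n : ℕ => k (stdBasis (some (n : ℤ)))) :=
        hy.continuousAt_comp (by fun_prop)
      have h2 : Tendsto ((fun z => ⟪w, z⟫_ℂ) ∘ fun n : ℕ => k (stdBasis (some (n : ℤ)))) atTop
          (𝓝 0) := by
        refine (tendsto_inner_stdBasis (ContinuousLinearMap.adjoint k w)).congr fun n => ?_
        exact ContinuousLinearMap.adjoint_inner_left _ _ _
      exact eq_of_nhds_neBot (ClusterPt.mono h1 h2)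
    exact inner_self_eq_zero.mp (hz y)

/-- Test on far basis vectors: the compact part sends them to a null sequence, so `x e_n` is
asymptotically the scalar times `e_n`. -/
theorem norm_scalarPart_le (x : boole) : ‖scalarPart x‖ ≤ ‖x‖ := by
  have h1 := (tendsto_compact_apply_stdBasis (isCompactOperator_compactPart x)).norm
  have h2 (n : ℕ) : ‖scalarPart x‖ ≤ ‖x‖ + ‖compactPart x (stdBasis (some (n : ℤ)))‖ := by
    have h3 : scalarPart x • stdBasis (some (n : ℤ)) = (x : Fock →L[ℂ] Fock) (stdBasis (some (n : ℤ)))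
        - compactPart x (stdBasis (some (n : ℤ))) := by
      simp [compactPart]
    calc ‖scalarPart x‖ = ‖scalarPart x • stdBasis (some (n : ℤ))‖ := by
          rw [norm_smul, norm_stdBasis, mul_one]
      _ ≤ _ := by
        rw [h3]
        refine (norm_sub_le _ _).trans (add_le_add_left ?_ _)
        have := (x : Fock →L[ℂ] Fock).le_opNorm (stdBasis (some (n : ℤ)))
        rwa [norm_stdBasis, mul_one] at this
  have h4 := h1.const_add ‖x‖
  rw [norm_zero, add_zero] at h4
  exact ge_of_tendsto' h4 h2

/-- The scalar part, as a bounded functional. -/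
def scalarFunctional : boole →L[ℂ] ℂ :=
  LinearMap.mkContinuous
    { toFun := scalarPart
      map_add' := fun x y => scalarPart_eq _ _ (by
        have h := (isCompactOperator_compactPart x).add (isCompactOperator_compactPart y)
        have e : ((x + y : boole) : Fock →L[ℂ] Fock) - (scalarPart x + scalarPart y) • 1 =
            compactPart x + compactPart y := by
          simp only [compactPart, add_smul, AddMemClass.coe_add]
          abel
        rw [e]
        exact h)
      map_smul' := fun c x => scalarPart_eq _ _ (by
        have h := (isCompactOperator_compactPart x).smul c
        have e : ((c • x : boole) : Fock →L[ℂ] Fock) - (c • scalarPart x) • 1 =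
            c • compactPart x := by
          rw [compactPart, smul_sub, smul_assoc]
          rfl
        rw [RingHom.id_apply, e]
        exact h) } 1
    fun x => by
      rw [one_mul]
      exact norm_scalarPart_le x

theorem scalarFunctional_apply (x : boole) : scalarFunctional x = scalarPart x := rfl

/-- The vacuum state `x ↦ ⟨x e_o, e_o⟩`, as a bounded functional. -/
def vacuumFunctional : boole →L[ℂ] ℂ :=
  LinearMap.mkContinuous
    { toFun := fun x => ⟪stdBasis none, (x : Fock →L[ℂ] Fock) (stdBasis none)⟫_ℂ
      map_add' := fun x y => by simp
      map_smul' := fun c x => by simp } 1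
    fun x => by
      refine (norm_inner_le_norm (𝕜 := ℂ) (stdBasis none)
        ((x : Fock →L[ℂ] Fock) (stdBasis none))).trans ?_
      rw [norm_stdBasis]
      have := (x : Fock →L[ℂ] Fock).le_opNorm (stdBasis none)
      rw [norm_stdBasis, mul_one] at this
      simpa using this

theorem vacuumFunctional_apply (x : boole) :
    vacuumFunctional x = ⟪stdBasis none, (x : Fock →L[ℂ] Fock) (stdBasis none)⟫_ℂ := rfl

/-- Since `⟨A e_o, e_o⟩ + b` is just `⟨x e_o, e_o⟩`, both coefficients are bounded linear
functionals of `x`. -/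
theorem booleExpectation_apply (x : boole) : booleExpectation x =
    vacuumFunctional x • vacuumProj + scalarFunctional x • (1 - vacuumProj) := by
  rw [booleExpectation, vacuumFunctional_apply, scalarFunctional_apply]
  congr 2
  simp [compactPart, norm_stdBasis]

theorem scalarPart_one : scalarPart 1 = 1 :=
  scalarPart_eq _ _ (by simpa using isCompactOperator_zero)

/-! ### Matrix units -/

theorem rankOne_mem (i : Option ℤ) :
    InnerProductSpace.rankOne ℂ (stdBasis i) (stdBasis none) ∈ boole := by
  cases i with
  | none => exact vacuumProjOp_mem
  | some j => exact creator_mem j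

/-- Factoring through the vacuum is what places every matrix unit in `boole`. -/
theorem rankOne_eq_mul_star (i j : Option ℤ) :
    InnerProductSpace.rankOne ℂ (stdBasis i) (stdBasis j) =
      InnerProductSpace.rankOne ℂ (stdBasis i) (stdBasis none) *
        star (InnerProductSpace.rankOne ℂ (stdBasis j) (stdBasis none)) := by
  ext1 x
  simp [ContinuousLinearMap.star_eq_adjoint, InnerProductSpace.rankOne_apply, norm_stdBasis]

/-- The matrix units of the boolean algebra. -/
def matrixUnit (i j : Option ℤ) : boole :=
  ⟨InnerProductSpace.rankOne ℂ (stdBasis i) (stdBasis j), by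
    rw [rankOne_eq_mul_star]
    exact mul_mem (rankOne_mem i) (star_mem (rankOne_mem j))⟩

theorem coe_matrixUnit (i j : Option ℤ) : (matrixUnit i j : Fock →L[ℂ] Fock) =
    InnerProductSpace.rankOne ℂ (stdBasis i) (stdBasis j) := rfl

theorem matrixUnit_none : matrixUnit none none = vacuumProj := rfl

theorem star_matrixUnit (i j : Option ℤ) : star (matrixUnit i j) = matrixUnit j i :=
  Subtype.ext (InnerProductSpace.adjoint_rankOne _ _)

theorem matrixUnit_mul (i j k l : Option ℤ) :
    matrixUnit i j * matrixUnit k l = (if j = k then (1 : ℂ) else 0) • matrixUnit i l := by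
  apply Subtype.ext
  ext1 v
  split_ifs with h <;>
    simp [coe_matrixUnit, InnerProductSpace.rankOne_apply, inner_stdBasis, h,
      norm_stdBasis]

theorem shift_matrixUnit (i j : Option ℤ) :
    shift (matrixUnit i j) = matrixUnit (shiftIndex i) (shiftIndex j) := by
  apply Subtype.ext
  rw [coe_shift]
  ext1 x
  have h : ⟪stdBasis j, shiftUnitary.symm x⟫_ℂ = ⟪stdBasis (shiftIndex j), x⟫_ℂ := by
    rw [← shiftUnitary.inner_map_map, shiftUnitary_apply, LinearIsometryEquiv.apply_symm_apply]
  simp [coe_matrixUnit, InnerProductSpace.rankOne_apply, shiftUnitary_apply, h]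

theorem shift_vacuumProj : shift vacuumProj = vacuumProj := shift_matrixUnit none none

theorem iterate_shift_matrixUnit (k : ℕ) (i j : Option ℤ) :
    shift^[k] (matrixUnit i j) = matrixUnit (shiftIndex^[k] i) (shiftIndex^[k] j) := by
  induction k generalizing i j with
  | zero => rfl
  | succ k ih => rw [Function.iterate_succ_apply, shift_matrixUnit, ih]; rfl

theorem iterate_shiftIndex_some (k : ℕ) (j : ℤ) : shiftIndex^[k] (some j) = some (j + k) := by
  induction k generalizing j with
  | zero => simp
  | succ k ih =>
    rw [Function.iterate_succ_apply, show shiftIndex (some j) = some (j + 1) from rfl, ih]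
    push_cast
    congr 1
    ring

theorem scalarFunctional_matrixUnit (i j : Option ℤ) : scalarFunctional (matrixUnit i j) = 0 :=
  scalarPart_eq _ _ (by
    rw [zero_smul, sub_zero]
    exact isCompactOperator_rankOne _ _)

theorem vacuumFunctional_matrixUnit (i j : Option ℤ) :
    vacuumFunctional (matrixUnit i j) = if i = none ∧ j = none then 1 else 0 := by
  cases i <;> cases j <;>
    simp [vacuumFunctional_apply, coe_matrixUnit, inner_stdBasis, norm_stdBasis]

/-- The linear span of the identity and of the matrix units. -/
def matrixUnitSpan : Submodule ℂ boole :=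
  Submodule.span ℂ (insert 1 (Set.range fun p : Option ℤ × Option ℤ => matrixUnit p.1 p.2))

theorem one_mem_matrixUnitSpan : (1 : boole) ∈ matrixUnitSpan :=
  Submodule.subset_span (Set.mem_insert _ _)

theorem matrixUnit_mem_span (i j : Option ℤ) : matrixUnit i j ∈ matrixUnitSpan :=
  Submodule.subset_span (Set.mem_insert_of_mem _ ⟨(i, j), rfl⟩)

theorem mul_mem_matrixUnitSpan {x y : boole} (hx : x ∈ matrixUnitSpan) (hy : y ∈ matrixUnitSpan) :
    x * y ∈ matrixUnitSpan := by
  have h : matrixUnitSpan * matrixUnitSpan ≤ matrixUnitSpan := by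
    conv_lhs => rw [matrixUnitSpan, Submodule.span_mul_span]
    rw [Submodule.span_le]
    rintro _ ⟨a, (rfl | ⟨p, rfl⟩), b, (rfl | ⟨q, rfl⟩), rfl⟩
    · simpa using one_mem_matrixUnitSpan
    · simpa using matrixUnit_mem_span _ _
    · simpa using matrixUnit_mem_span _ _
    · simp only [matrixUnit_mul]
      exact Submodule.smul_mem _ _ (matrixUnit_mem_span _ _)
  exact h (Submodule.mul_mem_mul hx hy)

theorem star_mem_matrixUnitSpan {x : boole} (hx : x ∈ matrixUnitSpan) :
    star x ∈ matrixUnitSpan := by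
  induction hx using Submodule.span_induction with
  | mem x h =>
    obtain rfl | ⟨p, rfl⟩ := h
    · simpa using one_mem_matrixUnitSpan
    · simpa only [star_matrixUnit] using matrixUnit_mem_span _ _
  | zero => simp
  | add x y _ _ hx hy => simpa using add_mem hx hy
  | smul c x _ hx => simpa using Submodule.smul_mem _ _ hx

/-- The linear span of the identity and of the matrix units is a dense `⋆`-subalgebra. -/
theorem closure_matrixUnitSpan : closure (matrixUnitSpan : Set boole) = Set.univ := by
  let W : StarSubalgebra ℂ boole :=
    { carrier := matrixUnitSpan
      mul_mem' := mul_mem_matrixUnitSpan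
      add_mem' := add_mem
      algebraMap_mem' := fun r => by
        rw [Algebra.algebraMap_eq_smul_one]
        exact Submodule.smul_mem _ _ one_mem_matrixUnitSpan
      star_mem' := star_mem_matrixUnitSpan }
  have hW : StarAlgebra.adjoin ℂ (Set.range creator) ≤ W.map boole.subtype := by
    refine StarAlgebra.adjoin_le ?_
    rintro _ ⟨j, rfl⟩
    exact ⟨matrixUnit (some j) none, matrixUnit_mem_span _ _, rfl⟩
  refine Set.eq_univ_of_forall fun x => ?_
  -- Closures in the subtype are traces of closures in the operator algebra, where `boole` is itself
  -- defined as a closure.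
  rw [Topology.IsInducing.subtypeVal.closure_eq_preimage_closure_image]
  refine closure_mono ?_ x.2
  exact hW

/-- Applied to a vector, the terms are mutually orthogonal because the row indices are distinct, and
each has norm at most `‖v‖`. No condition on the column indices is needed. -/
theorem norm_sum_matrixUnit_le (w : ℕ → ℂ) (hw : ∀ k, ‖w k‖ = 1) (i j : ℕ → Option ℤ)
    (hi : Function.Injective i) (n : ℕ) :
    ‖∑ k ∈ Finset.range n, w k • matrixUnit (i k) (j k)‖ ≤ √n := by
  change ‖((∑ k ∈ Finset.range n, w k • matrixUnit (i k) (j k) : boole) : Fock →L[ℂ] Fock)‖ ≤ √n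
  refine ContinuousLinearMap.opNorm_le_bound _ (Real.sqrt_nonneg _) fun v => ?_
  have h1 : ((∑ k ∈ Finset.range n, w k • matrixUnit (i k) (j k) : boole) : Fock →L[ℂ] Fock) v =
      ∑ k ∈ Finset.range n, (w k * ⟪stdBasis (j k), v⟫_ℂ) • stdBasis (i k) := by
    simp [coe_matrixUnit, InnerProductSpace.rankOne_apply, mul_smul]
  have h2 : ‖∑ k ∈ Finset.range n, (w k * ⟪stdBasis (j k), v⟫_ℂ) • stdBasis (i k)‖ ^ 2 =
      ∑ k ∈ Finset.range n, ‖w k * ⟪stdBasis (j k), v⟫_ℂ‖ ^ 2 := by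
    have h := (stdBasis.orthonormal.comp i hi).inner_sum (fun k => w k * ⟪stdBasis (j k), v⟫_ℂ)
      (fun k => w k * ⟪stdBasis (j k), v⟫_ℂ) (Finset.range n)
    simp only [Function.comp_apply, inner_self_eq_norm_sq_to_K, RCLike.conj_mul] at h
    exact_mod_cast h
  rw [h1, ← sq_le_sq₀ (norm_nonneg _) (by positivity), h2, mul_pow, Real.sq_sqrt (Nat.cast_nonneg n)]
  refine (Finset.sum_le_card_nsmul _ _ (‖v‖ ^ 2) fun k _ => ?_).trans (by simp)
  rw [norm_mul, hw, one_mul]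
  gcongr
  exact (norm_inner_le_norm _ _).trans_eq (by rw [norm_stdBasis, one_mul])

/-- The shift moves the row index through distinct values, so the `√n` bound divided by `n` decays
for every weight. -/
theorem tendsto_cesaro_matrixUnit_some (lam : Circle) (i : ℤ) (j : Option ℤ) :
    Tendsto (cesaro shift lam (matrixUnit (some i) j)) atTop (𝓝 0) := by
  refine squeeze_zero_norm (a := fun n : ℕ => (√n)⁻¹) (fun n => ?_) ?_
  · have h := norm_sum_matrixUnit_le (fun k => (lam : ℂ) ^ (-(k : ℤ)))
      (fun k => by rw [norm_zpow, Circle.norm_coe, one_zpow])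
      (fun k => shiftIndex^[k] (some i)) (fun k => shiftIndex^[k] j) (fun k l hkl => by
        simpa [iterate_shiftIndex_some] using hkl) n
    simp only [cesaro, iterate_shift_matrixUnit]
    rw [norm_smul, norm_inv, Complex.norm_natCast]
    refine (mul_le_mul_of_nonneg_left h (by positivity)).trans_eq ?_
    rw [inv_mul_eq_div, Real.sqrt_div_self]
  · exact (Real.tendsto_sqrt_atTop.comp tendsto_natCast_atTop_atTop).inv_tendsto_atTop

/-! ### Limits of the weighted averages of the shift -/

open scoped Classical in
/-- The limits of the averages for the shift. -/
def shiftLimit (lam : Circle) : boole →L[ℂ] boole :=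
  if lam = 1 then
    vacuumFunctional.smulRight vacuumProj + scalarFunctional.smulRight (1 - vacuumProj)
  else 0

theorem shiftLimit_one_apply (x : boole) : shiftLimit 1 x = booleExpectation x := by
  rw [shiftLimit, if_pos rfl, booleExpectation_apply]
  rfl

theorem shiftLimit_of_ne {lam : Circle} (h : lam ≠ 1) : shiftLimit lam = 0 := if_neg h

theorem tendsto_cesaro_shift_of_fixed (lam : Circle) {x : boole} (hx : shift x = x)
    (hE : booleExpectation x = x) : Tendsto (cesaro shift lam x) atTop (𝓝 (shiftLimit lam x)) := by
  have hx' : x ∈ eigenspace shift 1 := (mem_fixedPoints_iff_mem_eigenspace shift).mp hx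
  by_cases h : lam = 1
  · subst h
    rw [shiftLimit_one_apply, hE]
    exact tendsto_cesaro_of_mem_eigenspace hx'
  · rw [shiftLimit_of_ne h]
    exact tendsto_cesaro_of_mem_eigenspace_of_ne hx' h

theorem shiftLimit_matrixUnit (lam : Circle) (i j : Option ℤ) (h : ¬(i = none ∧ j = none)) :
    shiftLimit lam (matrixUnit i j) = 0 := by
  by_cases hl : lam = 1
  · rw [hl, shiftLimit_one_apply, booleExpectation_apply, scalarFunctional_matrixUnit,
      vacuumFunctional_matrixUnit, if_neg h]
    simp
  · rw [shiftLimit_of_ne hl]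
    rfl

theorem booleExpectation_one : booleExpectation 1 = 1 := by
  rw [booleExpectation_apply, scalarFunctional_apply, scalarPart_one, vacuumFunctional_apply]
  simp [norm_stdBasis]

theorem booleExpectation_vacuumProj : booleExpectation vacuumProj = vacuumProj := by
  rw [← matrixUnit_none, booleExpectation_apply, scalarFunctional_matrixUnit,
    vacuumFunctional_matrixUnit]
  simp [matrixUnit_none]

theorem tendsto_cesaro_shift (lam : Circle) (x : boole) :
    Tendsto (cesaro shift lam x) atTop (𝓝 (shiftLimit lam x)) := by
  refine tendsto_cesaro_of_mem_closure_span shift lam (shiftLimit lam) ?_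
    (closure_matrixUnitSpan ▸ Set.mem_univ x)
  rintro _ (rfl | ⟨⟨_ | i, _ | j⟩, rfl⟩)
  · exact tendsto_cesaro_shift_of_fixed lam (map_one _) booleExpectation_one
  · exact tendsto_cesaro_shift_of_fixed lam shift_vacuumProj booleExpectation_vacuumProj
  -- Here the row index is the fixed vacuum; adjoints exchange row and column and invert the weight.
  · rw [shiftLimit_matrixUnit _ _ _ (by simp)]
    have h := (tendsto_cesaro_matrixUnit_some lam⁻¹ j none).star
    rw [star_zero] at h
    refine h.congr fun n => ?_
    rw [star_cesaro, inv_inv, star_matrixUnit]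
  · rw [shiftLimit_matrixUnit _ _ _ (by simp)]
    exact tendsto_cesaro_matrixUnit_some lam i none
  · rw [shiftLimit_matrixUnit _ _ _ (by simp)]
    exact tendsto_cesaro_matrixUnit_some lam i (some j)

set_option synthInstance.maxHeartbeats 400000

/-! ### Density of the vector-valued trigonometric polynomials -/

/-- The scalar monomial `z ↦ z^m`. -/
def zpowMap (m : ℤ) : C(Circle, ℂ) :=
  ⟨fun z => ((z ^ m : Circle) : ℂ), continuous_circle_coe.comp (continuous_zpow m)⟩

theorem zpowMap_apply (m : ℤ) (z : Circle) : zpowMap m z = ((z ^ m : Circle) : ℂ) := rfl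

/-- This is density of the Fourier monomials on the additive circle, transported along its
homeomorphism with `Circle`. -/
theorem closure_span_zpowMap :
    closure (Submodule.span ℂ (Set.range zpowMap) : Set C(Circle, ℂ)) = Set.univ := by
  have : Fact (0 < 2 * Real.pi) := ⟨Real.two_pi_pos⟩
  have h2π : (2 * Real.pi) ≠ 0 := Real.two_pi_pos.ne'
  let h : AddCircle (2 * Real.pi) ≃ₜ Circle := AddCircle.homeomorphCircle h2π
  let T : C(AddCircle (2 * Real.pi), ℂ) →ₗ[ℂ] C(Circle, ℂ) :=
    { toFun := fun g => g.comp ⟨h.symm, h.symm.continuous⟩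
      map_add' := fun _ _ => rfl
      map_smul' := fun _ _ => rfl }
  have hT : Continuous T := ContinuousMap.continuous_precomp _
  have hspan : T '' (Submodule.span ℂ (Set.range (@fourier (2 * Real.pi))) : Set _) ⊆
      Submodule.span ℂ (Set.range zpowMap) := by
    rw [← Submodule.map_coe, Submodule.map_span]
    refine Submodule.span_mono ?_
    rintro _ ⟨_, ⟨m, rfl⟩, rfl⟩
    refine ⟨m, ?_⟩
    ext z
    obtain ⟨y, rfl⟩ := h.surjective z
    change (((h y) ^ m : Circle) : ℂ) = fourier m (h.symm (h y))
    rw [h.symm_apply_apply, fourier_apply, AddCircle.toCircle_zsmul,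
      AddCircle.homeomorphCircle_apply]
  refine Set.eq_univ_of_forall fun g => ?_
  have hg : T (g.comp ⟨h, h.continuous⟩) = g := by
    ext z
    exact congrArg g (h.apply_symm_apply z)
  rw [← hg]
  refine closure_mono hspan (image_closure_subset_closure_image hT ⟨_, ?_, rfl⟩)
  have := @span_fourier_closure_eq_top (2 * Real.pi) _
  rw [← Submodule.topologicalClosure_coe, this]
  trivial

/-- The function `z ↦ g(z) x`. -/
def tensor (x : boole) : C(Circle, ℂ) →L[ℂ] Alg :=
  (ContinuousLinearMap.toSpanSingleton ℂ x).compLeftContinuous ℂ Circle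

theorem tensor_apply (x : boole) (g : C(Circle, ℂ)) (z : Circle) : tensor x g z = g z • x := rfl

/-- Cover the circle by finitely many open sets on which `f` is ε-close to its value at a centre,
and glue these values with a subordinate partition of unity. -/
theorem closure_span_tensor :
    closure (Submodule.span ℂ
      (Set.range fun p : boole × C(Circle, ℂ) => tensor p.1 p.2) : Set Alg) = Set.univ := by
  refine Set.eq_univ_of_forall fun f => (Metric.mem_closure_iff (α := Alg)).mpr fun ε hε => ?_
  have hopen (z : Circle) : IsOpen {w | dist (f w) (f z) < ε} :=
    isOpen_lt (by fun_prop) continuous_const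
  obtain ⟨t, ht⟩ := CompactSpace.elim_nhds_subcover (fun z => {w | dist (f w) (f z) < ε})
    fun z => (hopen z).mem_nhds (by simpa using hε)
  obtain ⟨ρ, hρ⟩ := PartitionOfUnity.exists_isSubordinate isClosed_univ
    (fun i : t => {w | dist (f w) (f i) < ε}) (fun i => hopen i) (fun w _ => by
      have hw : w ∈ ⋃ x ∈ t, {w | dist (f w) (f x) < ε} := ht ▸ Set.mem_univ w
      obtain ⟨x, hx, hwx⟩ := Set.mem_iUnion₂.mp hw
      exact Set.mem_iUnion.mpr ⟨⟨x, hx⟩, hwx⟩)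
  let g (i : t) : C(Circle, ℂ) := ⟨fun w => ((ρ i w : ℝ) : ℂ), by fun_prop⟩
  refine ⟨∑ i : t, tensor (f i) (g i), Submodule.sum_mem _ fun i _ =>
    Submodule.subset_span ⟨(f i, g i), rfl⟩, ?_⟩
  rw [ContinuousMap.dist_lt_iff hε]
  intro w
  -- At `w` the sum is a convex combination of values in the ball of radius ε about `f w`, and balls
  -- are convex.
  have h := ρ.finsum_smul_mem_convex (g := fun (i : t) _ => f i) (t := Metric.ball (f w) ε)
    (Set.mem_univ w) (fun i hi => ?_) (convex_ball _ _)
  · rw [finsum_eq_sum_of_fintype, Metric.mem_ball, dist_comm] at h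
    rw [ContinuousMap.sum_apply]
    exact h
  · rw [Metric.mem_ball, dist_comm]
    exact hρ i (subset_closure hi)

/-- The monomials `z ↦ z^m x`, with `x` in the boolean algebra, span a dense subspace. -/
theorem closure_span_monomial :
    closure (Submodule.span ℂ
      (Set.range fun p : boole × ℤ => tensor p.1 (zpowMap p.2)) : Set Alg) = Set.univ := by
  set S : Submodule ℂ Alg :=
    Submodule.span ℂ (Set.range fun p : boole × ℤ => tensor p.1 (zpowMap p.2)) with hS
  have h1 : Submodule.span ℂ (Set.range fun p : boole × C(Circle, ℂ) => tensor p.1 p.2) ≤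
      S.topologicalClosure := by
    rw [Submodule.span_le]
    rintro _ ⟨⟨x, g⟩, rfl⟩
    have hg : g ∈ closure (Submodule.span ℂ (Set.range zpowMap) : Set C(Circle, ℂ)) :=
      closure_span_zpowMap ▸ Set.mem_univ g
    refine closure_mono ?_ (image_closure_subset_closure_image (tensor x).continuous ⟨g, hg, rfl⟩)
    have : (tensor x : C(Circle, ℂ) →ₗ[ℂ] Alg) '' (Submodule.span ℂ (Set.range zpowMap) : Set _) ⊆
        S := by
      rw [← Submodule.map_coe, Submodule.map_span]
      refine Submodule.span_mono ?_
      rintro _ ⟨_, ⟨m, rfl⟩, rfl⟩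
      exact ⟨(x, m), rfl⟩
    exact this
  refine Set.eq_univ_of_univ_subset ?_
  rw [← closure_span_tensor]
  exact closure_minimal h1 isClosed_closure

theorem mem_closure_span_monomial (f : Alg) :
    f ∈ closure (Submodule.span ℂ
      (Set.range fun p : boole × ℤ => tensor p.1 (zpowMap p.2)) : Set Alg) := by
  rw [closure_span_monomial]
  trivial

/-! ### Fourier coefficients -/

/-- The functional `g ↦ ∮ g(z) dz / (2πi z^{l+1})`. -/
def fourierFunctional (l : ℤ) : C(Circle, ℂ) →L[ℂ] ℂ :=
  LinearMap.mkContinuous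
    { toFun := fun g => (2 * Real.pi : ℂ)⁻¹ *
        ∫ t in (0 : ℝ)..(2 * Real.pi), zpowMap (-l) (Circle.exp t) * g (Circle.exp t)
      map_add' := fun g h => by
        simp only [ContinuousMap.add_apply, mul_add]
        rw [intervalIntegral.integral_add, mul_add] <;>
          exact Continuous.intervalIntegrable (by fun_prop) _ _
      map_smul' := fun c g => by
        simp only [ContinuousMap.smul_apply, smul_eq_mul, RingHom.id_apply, mul_left_comm _ c]
        rw [intervalIntegral.integral_const_mul, mul_left_comm] } 1
    fun g => by
      have h := intervalIntegral.norm_integral_le_of_norm_le_const (a := 0) (b := 2 * Real.pi)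
        (f := fun t : ℝ => zpowMap (-l) (Circle.exp t) * g (Circle.exp t)) (C := ‖g‖) fun t _ => by
          rw [norm_mul, zpowMap_apply, Circle.norm_coe, one_mul]
          exact g.norm_coe_le_norm _
      rw [sub_zero, abs_of_pos Real.two_pi_pos] at h
      change ‖(2 * Real.pi : ℂ)⁻¹ * _‖ ≤ _
      have h2 : ‖(2 * Real.pi : ℂ)‖ = 2 * Real.pi := by
        rw [← Complex.ofReal_ofNat, ← Complex.ofReal_mul, Complex.norm_real,
          Real.norm_of_nonneg Real.two_pi_pos.le]
      rw [norm_mul, norm_inv, h2, one_mul, inv_mul_le_iff₀ Real.two_pi_pos, mul_comm _ ‖g‖]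
      exact h

theorem fourierFunctional_apply (l : ℤ) (g : C(Circle, ℂ)) :
    fourierFunctional l g = (2 * Real.pi : ℂ)⁻¹ *
      ∫ t in (0 : ℝ)..(2 * Real.pi), zpowMap (-l) (Circle.exp t) * g (Circle.exp t) := rfl

theorem fourierFunctional_zpowMap (l m : ℤ) :
    fourierFunctional l (zpowMap m) = if m = l then 1 else 0 := by
  have hπ : (2 * Real.pi : ℂ) ≠ 0 := by exact_mod_cast Real.two_pi_pos.ne'
  have h (t : ℝ) : zpowMap (-l) (Circle.exp t) * zpowMap m (Circle.exp t) =
      Complex.exp (((m - l : ℤ) * Complex.I) * t) := by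
    rw [zpowMap_apply, zpowMap_apply, ← Circle.coe_mul, ← zpow_add, neg_add_eq_sub,
      Circle.coe_zpow, Circle.coe_exp, ← Complex.exp_int_mul]
    ring_nf
  rw [fourierFunctional_apply]
  simp only [h]
  split_ifs with hlm
  · subst hlm
    simp only [sub_self, Int.cast_zero, zero_mul, Complex.exp_zero, intervalIntegral.integral_const,
      sub_zero, Complex.real_smul, mul_one]
    push_cast
    exact inv_mul_cancel₀ hπ
  · have hc : ((m - l : ℤ) * Complex.I : ℂ) ≠ 0 :=
      mul_ne_zero (by exact_mod_cast sub_ne_zero.mpr hlm) Complex.I_ne_zero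
    rw [integral_exp_mul_complex hc]
    have h1 : ((m - l : ℤ) * Complex.I : ℂ) * ((2 * Real.pi : ℝ) : ℂ) =
        (m - l : ℤ) * (2 * Real.pi * Complex.I) := by
      push_cast
      ring
    rw [h1, Complex.exp_int_mul_two_pi_mul_I]
    simp

/-- A bounded functional of the boolean algebra, applied pointwise. -/
def pointwise (ψ : boole →L[ℂ] ℂ) : Alg →L[ℂ] C(Circle, ℂ) := ψ.compLeftContinuous ℂ Circle

theorem pointwise_apply (ψ : boole →L[ℂ] ℂ) (f : Alg) (z : Circle) : pointwise ψ f z = ψ (f z) :=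
  rfl

/-- The integrand splits along `P` and `1 - P`, so the operator-valued integral reduces to two
scalar Fourier coefficients, visibly bounded and linear in `f`. -/
theorem coefficient_eq (l : ℤ) (f : Alg) : coefficient l f =
    fourierFunctional l (pointwise vacuumFunctional f) • vacuumProj +
      fourierFunctional l (pointwise scalarFunctional f) • (1 - vacuumProj) := by
  have h (t : ℝ) : (Complex.I * (Circle.exp t : ℂ)) •
      (2 * Real.pi * Complex.I * (Circle.exp t : ℂ) ^ (l + 1))⁻¹ • booleExpectation (f (Circle.exp t)) =
      ((2 * Real.pi : ℂ)⁻¹ *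
        (zpowMap (-l) (Circle.exp t) * pointwise vacuumFunctional f (Circle.exp t))) • vacuumProj +
      ((2 * Real.pi : ℂ)⁻¹ *
        (zpowMap (-l) (Circle.exp t) * pointwise scalarFunctional f (Circle.exp t))) •
          (1 - vacuumProj) := by
    -- On the circle `dz = i z dt`, which cancels the factor `i` and one power of `z`.
    have hc : Complex.I * (Circle.exp t : ℂ) *
        (2 * Real.pi * Complex.I * (Circle.exp t : ℂ) ^ (l + 1))⁻¹ =
        (2 * Real.pi : ℂ)⁻¹ * zpowMap (-l) (Circle.exp t) := by
      have h0 := (Circle.exp t).coe_ne_zero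
      have hI := Complex.I_ne_zero
      rw [zpowMap_apply, Circle.coe_zpow, zpow_neg, zpow_add₀ h0, zpow_one, mul_inv, mul_inv,
        mul_inv]
      field_simp
    rw [smul_smul, hc, booleExpectation_apply, smul_add, smul_smul, smul_smul, mul_assoc,
      mul_assoc]
    rfl
  rw [coefficient, contourIntegral]
  simp only [h]
  rw [intervalIntegral.integral_add]
  · refine (congrArg₂ (· + ·) (intervalIntegral.integral_smul_const (𝕜 := ℂ) _ vacuumProj)
      (intervalIntegral.integral_smul_const (𝕜 := ℂ) _ (1 - vacuumProj))).trans ?_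
    rw [intervalIntegral.integral_const_mul, intervalIntegral.integral_const_mul]
    rfl
  all_goals exact Continuous.intervalIntegrable (by fun_prop) _ _

/-! ### The averages -/

theorem eigval_eq_zpow (θ : ℝ) (l : ℤ) : eigval θ l = Circle.exp (2 * Real.pi * θ) ^ l := by
  rw [eigval, ← Circle.exp_zsmul, zsmul_eq_mul]
  congr 1
  ring

/-- This is where irrationality enters: a coincidence would make `(l - m)θ` an integer with `l ≠ m`.
-/
theorem eigval_injective {θ : ℝ} (hθ : Irrational θ) : Function.Injective (eigval θ) := by
  intro l m h
  obtain ⟨k, hk⟩ := Circle.exp_eq_exp.mp h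
  by_contra hne
  have h1 : ((l - m : ℤ) : ℝ) * θ = k := by
    have h2 : 2 * Real.pi * (((l - m : ℤ) : ℝ) * θ) = 2 * Real.pi * k := by
      push_cast
      linear_combination hk
    exact mul_left_cancel₀ Real.two_pi_pos.ne' h2
  exact (hθ.intCast_mul (sub_ne_zero.mpr hne)).ne_int k h1

theorem alpha_apply (θ : ℝ) (f : Alg) (z : Circle) :
    alpha θ f z = shift (f (Circle.exp (2 * Real.pi * θ) * z)) := rfl

theorem u_apply (l : ℤ) (z : Circle) : u l z = ((z ^ l : Circle) : ℂ) • (1 : boole) := rfl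

theorem u_mul_comm (l : ℤ) (f : Alg) : u l * f = f * u l := by
  ext1 z
  simp [u_apply]

theorem u_mem_unitary (l : ℤ) : u l ∈ unitary Alg := by
  have h : star (u l) * u l = 1 := by
    ext1 z
    simp only [ContinuousMap.mul_apply, ContinuousMap.star_apply, u_apply, star_smul, star_one,
      smul_mul_smul_comm, mul_one, ContinuousMap.one_apply]
    rw [Complex.star_def, ← Circle.coe_inv_eq_conj, ← Circle.coe_mul, inv_mul_cancel,
      Circle.coe_one, one_smul]
  exact Unitary.mem_iff.mpr ⟨h, (u_mul_comm l _).trans h⟩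

theorem alpha_u (θ : ℝ) (l : ℤ) : alpha θ (u l) = (eigval θ l : ℂ) • u l := by
  ext1 z
  rw [alpha_apply, ContinuousMap.smul_apply, u_apply, u_apply, map_smul, map_one, smul_smul,
    mul_zpow, Circle.coe_mul, eigval_eq_zpow]

theorem u_mem_eigenspace (θ : ℝ) (l : ℤ) : u l ∈ eigenspace (alpha θ) (eigval θ l) :=
  Module.End.mem_eigenspace_iff.mpr (alpha_u θ l)

theorem alpha_const (θ : ℝ) (x : boole) :
    alpha θ (ContinuousMap.const Circle x) = ContinuousMap.const Circle (shift x) := rfl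

theorem tensor_zpowMap (x : boole) (m : ℤ) :
    tensor x (zpowMap m) = u m * ContinuousMap.const Circle x := by
  ext1 z
  simp [tensor_apply, zpowMap_apply, u_apply]

theorem iterate_alpha_const (θ : ℝ) (k : ℕ) (x : boole) :
    (alpha θ)^[k] (ContinuousMap.const Circle x) = ContinuousMap.const Circle (shift^[k] x) := by
  induction k generalizing x with
  | zero => rfl
  | succ k ih => rw [Function.iterate_succ_apply, alpha_const, ih, Function.iterate_succ_apply]

/-- The rotation acts on `u m` by the scalar `λ_m`, which is absorbed into the weight; only the
shift on `x` remains. -/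
theorem cesaro_u_mul_const (θ : ℝ) (lam : Circle) (m : ℤ) (x : boole) (n : ℕ) :
    cesaro (alpha θ) lam (u m * ContinuousMap.const Circle x) n =
      u m * ContinuousMap.const Circle (cesaro shift (lam / eigval θ m) x n) := by
  have h (k : ℕ) : (lam : ℂ) ^ (-(k : ℤ)) •
      (alpha θ)^[k] (u m * ContinuousMap.const Circle x) =
      u m * ContinuousMap.const Circle
        (((lam / eigval θ m : Circle) : ℂ) ^ (-(k : ℤ)) • shift^[k] x) := by
    rw [iterate_endo_mul, iterate_of_mem_eigenspace (u_mem_eigenspace θ m), iterate_alpha_const,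
      smul_mul_assoc, smul_smul, Circle.coe_div, div_zpow, zpow_neg (eigval θ m : ℂ), div_inv_eq_mul,
      zpow_natCast]
    ext1 z
    simp
  simp only [cesaro, h]
  ext1 z
  simp [Finset.mul_sum]

/-- The limit of the averages at the eigenvalue `λ_l`. -/
def eigenLimit (l : ℤ) : Alg →L[ℂ] Alg :=
  ((fourierFunctional l).comp (pointwise vacuumFunctional)).smulRight
      (ContinuousMap.const Circle vacuumProj * u l) +
    ((fourierFunctional l).comp (pointwise scalarFunctional)).smulRight
      (ContinuousMap.const Circle (1 - vacuumProj) * u l)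

theorem eigenLimit_apply (l : ℤ) (f : Alg) :
    eigenLimit l f = ContinuousMap.const Circle (coefficient l f) * u l := by
  rw [coefficient_eq]
  ext1 z
  simp [eigenLimit, add_mul]

theorem pointwise_tensor (ψ : boole →L[ℂ] ℂ) (x : boole) (g : C(Circle, ℂ)) :
    pointwise ψ (tensor x g) = ψ x • g := by
  ext z
  simp [pointwise_apply, tensor_apply, mul_comm]

theorem eigenLimit_tensor_self (m : ℤ) (x : boole) : eigenLimit m (tensor x (zpowMap m)) =
    u m * ContinuousMap.const Circle (booleExpectation x) := by
  rw [eigenLimit_apply, coefficient_eq, pointwise_tensor, pointwise_tensor, map_smul, map_smul,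
    fourierFunctional_zpowMap, booleExpectation_apply, if_pos rfl, u_mul_comm, smul_eq_mul,
    smul_eq_mul, mul_one, mul_one]

theorem eigenLimit_tensor_of_ne {l m : ℤ} (h : m ≠ l) (x : boole) :
    eigenLimit l (tensor x (zpowMap m)) = 0 := by
  rw [eigenLimit_apply, coefficient_eq, pointwise_tensor, pointwise_tensor, map_smul, map_smul,
    fourierFunctional_zpowMap, if_neg h]
  ext1 z
  simp

theorem tendsto_cesaro_tensor (θ : ℝ) (lam : Circle) (m : ℤ) (x : boole) :
    Tendsto (cesaro (alpha θ) lam (tensor x (zpowMap m))) atTop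
      (𝓝 (u m * ContinuousMap.const Circle (shiftLimit (lam / eigval θ m) x))) := by
  rw [tensor_zpowMap, funext (cesaro_u_mul_const θ lam m x)]
  exact (((ContinuousMap.continuous_const'.tendsto _).comp
    (tendsto_cesaro_shift (lam / eigval θ m) x))).const_mul (u m)

theorem tendsto_cesaro_tensor_self (θ : ℝ) (m : ℤ) (x : boole) :
    Tendsto (cesaro (alpha θ) (eigval θ m) (tensor x (zpowMap m))) atTop
      (𝓝 (u m * ContinuousMap.const Circle (booleExpectation x))) := by
  have h := tendsto_cesaro_tensor θ (eigval θ m) m x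
  rwa [div_self', shiftLimit_one_apply] at h

theorem tendsto_cesaro_tensor_of_ne {θ : ℝ} {lam : Circle} {m : ℤ} (h : lam ≠ eigval θ m)
    (x : boole) : Tendsto (cesaro (alpha θ) lam (tensor x (zpowMap m))) atTop (𝓝 0) := by
  have h0 : u m * ContinuousMap.const Circle (shiftLimit (lam / eigval θ m) x) = 0 := by
    rw [shiftLimit_of_ne (div_ne_one.mpr h)]
    ext1 z
    simp
  exact h0 ▸ tendsto_cesaro_tensor θ lam m x

theorem tendsto_cesaro_eigval {θ : ℝ} (hθ : Irrational θ) (l : ℤ) (f : Alg) :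
    Tendsto (cesaro (alpha θ) (eigval θ l) f) atTop (𝓝 (eigenLimit l f)) := by
  have hf := mem_closure_span_monomial f
  refine tendsto_cesaro_of_mem_closure_span (alpha θ) (eigval θ l) (eigenLimit l) ?_ hf
  rintro _ ⟨⟨x, m⟩, rfl⟩
  by_cases hml : m = l
  · subst hml
    have e := eigenLimit_tensor_self m x
    have h := tendsto_cesaro_tensor_self θ m x
    rw [← e] at h
    exact h
  -- For `m ≠ l` injectivity of the eigenvalues makes the residual weight different from 1, so the
  -- averages vanish.
  · have e := eigenLimit_tensor_of_ne hml x
    have h := tendsto_cesaro_tensor_of_ne (θ := θ) (fun h => hml (eigval_injective hθ h.symm)) x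
    rw [← e] at h
    exact h

theorem tendsto_cesaro_of_notMem_range {θ : ℝ} {lam : Circle}
    (hlam : lam ∉ Set.range (eigval θ)) (f : Alg) :
    Tendsto (cesaro (alpha θ) lam f) atTop (𝓝 0) := by
  refine tendsto_cesaro_of_mem_closure_span _ _ 0 ?_ (mem_closure_span_monomial f)
  rintro _ ⟨⟨x, m⟩, rfl⟩
  exact tendsto_cesaro_tensor_of_ne (fun h => hlam ⟨m, h.symm⟩) x

theorem const_mul_u_zero (x : boole) :
    ContinuousMap.const Circle x * u 0 = ContinuousMap.const Circle x := by
  ext1 z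
  simp [u_apply]

theorem expectation_eq_eigenLimit (f : Alg) : expectation f = eigenLimit 0 f := by
  rw [eigenLimit_apply, const_mul_u_zero, expectation, coefficient]
  simp only [zero_add, zpow_one]

theorem eigval_zero (θ : ℝ) : eigval θ 0 = 1 := by
  simp [eigval]

theorem tendsto_cesaro_one {θ : ℝ} (hθ : Irrational θ) (f : Alg) :
    Tendsto (cesaro (alpha θ) 1 f) atTop (𝓝 (expectation f)) := by
  rw [expectation_eq_eigenLimit, ← eigval_zero θ]
  exact tendsto_cesaro_eigval hθ 0 f

/-! ### Fixed points, eigenspaces and spectra -/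

theorem const_mem_fixedPoints (θ : ℝ) (c d : ℂ) :
    ContinuousMap.const Circle (c • vacuumProj + d • (1 - vacuumProj)) ∈ fixedPoints (alpha θ) := by
  rw [mem_fixedPoints_iff, alpha_const]
  simp only [map_add, map_smul, map_sub, map_one, shift_vacuumProj]

/-- A fixed point equals its own expectation, and `coefficient_eq` exhibits expectations as
constants of this shape. -/
theorem coe_fixedPoints_alpha {θ : ℝ} (hθ : Irrational θ) :
    (fixedPoints (alpha θ) : Set Alg) =
      {f | ∃ c d : ℂ, f = ContinuousMap.const Circle (c • vacuumProj + d • (1 - vacuumProj))} := by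
  ext f
  refine ⟨fun hf => ?_, ?_⟩
  · have h := limit_fixes (tendsto_cesaro_one hθ) hf
    rw [expectation_eq_eigenLimit, eigenLimit_apply, const_mul_u_zero, coefficient_eq] at h
    exact ⟨_, _, h.symm⟩
  · rintro ⟨c, d, rfl⟩
    exact const_mem_fixedPoints θ c d

/-- An eigenvector is the limit of its own averages, and that limit is `u l` times a constant fixed
point. -/
theorem coe_eigenspace_alpha {θ : ℝ} (hθ : Irrational θ) (l : ℤ) :
    (eigenspace (alpha θ) (eigval θ l) : Set Alg) =
      (fun a => u l * a) '' (fixedPoints (alpha θ) : Set Alg) := by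
  ext f
  constructor
  · intro hf
    have h := eq_of_mem_eigenspace hf (tendsto_cesaro_eigval hθ l f)
    rw [eigenLimit_apply, ← u_mul_comm, coefficient_eq] at h
    exact ⟨_, const_mem_fixedPoints θ _ _, h.symm⟩
  · rintro ⟨a, ha, rfl⟩
    refine Module.End.mem_eigenspace_iff.mpr ?_
    change alpha θ (u l * a) = _
    rw [map_mul, alpha_u, (mem_fixedPoints_iff _).mp ha, smul_mul_assoc]

theorem u_ne_zero (l : ℤ) : u l ≠ 0 := by
  intro h
  have h1 : u l 1 = 0 := congrArg (fun f : Alg => f 1) h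
  rw [u_apply, one_zpow, Circle.coe_one, one_smul] at h1
  have h2 := congrArg scalarFunctional h1
  rw [map_zero, scalarFunctional_apply, scalarPart_one] at h2
  exact one_ne_zero h2

theorem purePointSpectrum_alpha (θ : ℝ) :
    purePointSpectrum (alpha θ) = Set.range (eigval θ) := by
  ext lam
  constructor
  · intro h
    by_contra hlam
    obtain ⟨f, hf⟩ := Module.End.HasEigenvalue.exists_hasEigenvector h
    exact hf.2 (eq_of_mem_eigenspace hf.1 (tendsto_cesaro_of_notMem_range hlam f))
  · rintro ⟨l, rfl⟩
    exact Module.End.hasEigenvalue_of_hasEigenvector ⟨u_mem_eigenspace θ l, u_ne_zero l⟩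

open scoped ComplexOrder in
-- Evaluate at `z = 1`, take the vacuum state, and compose with the expectation.
theorem exists_invariant_state_alpha {θ : ℝ} (hθ : Irrational θ) :
    ∃ φ : State Alg, φ.IsInvariant (alpha θ) := by
  refine exists_invariant_state (tendsto_cesaro_one hθ)
    { toFun := fun f => vacuumFunctional (f 1)
      map_add' := fun _ _ => map_add vacuumFunctional _ _
      map_smul' := fun _ _ => map_smul vacuumFunctional _ _ } (fun f => ?_) ?_
  · change 0 ≤ ⟪stdBasis none, (ContinuousLinearMap.adjoint ((f 1 : boole) : Fock →L[ℂ] Fock))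
      (((f 1 : boole) : Fock →L[ℂ] Fock) (stdBasis none))⟫_ℂ
    rw [ContinuousLinearMap.adjoint_inner_right]
    rw [inner_self_eq_norm_sq_to_K, ← RCLike.ofReal_pow]
    exact RCLike.ofReal_nonneg.mpr (sq_nonneg _)
  · change ⟪stdBasis none, stdBasis none⟫_ℂ = 1
    rw [inner_stdBasis, if_pos rfl]

theorem fullPurePointSpectrum_alpha {θ : ℝ} (hθ : Irrational θ) :
    fullPurePointSpectrum (alpha θ) = Set.range (eigval θ) := by
  refine Set.Subset.antisymm (fun lam h => ?_) ?_
  · by_contra hlam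
    exact notMem_fullPurePointSpectrum_of_tendsto (tendsto_cesaro_of_notMem_range hlam) h
  · rintro _ ⟨l, rfl⟩
    obtain ⟨φ, hφ⟩ := exists_invariant_state_alpha hθ
    refine mem_fullPurePointSpectrum_of_mem_eigenspace φ hφ (u_mem_eigenspace θ l) ?_
    -- By unitarity the GNS vector of `u l` has norm one in every state.
    rw [Unitary.star_mul_self_of_mem (u_mem_unitary l), φ.map_one]
    exact one_ne_zero

end

end BooleanRotation

open BooleanRotation
theorem mainTheorem6 (θ : ℝ) (hθ : Irrational θ) :
    -- unique ergodicity w.r.t. the fixed-point subalgebra, with expectation `E₁`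
    IsUniquelyErgodicWithExpectation (alpha θ) expectation ∧
    -- the fixed-point subalgebra consists of the constants with values in `ℂ P ⊕ ℂ (I - P)`
    (fixedPoints (alpha θ) : Set Alg) =
      {f | ∃ c d : ℂ, f = ContinuousMap.const Circle (c • vacuumProj + d • (1 - vacuumProj))} ∧
    -- the spectra
    purePointSpectrum (alpha θ) = Set.range (eigval θ) ∧
    fullPurePointSpectrum (alpha θ) = Set.range (eigval θ) ∧
    -- the eigenspaces
    (∀ l : ℤ, u l ∈ unitary Alg ∧ u l ∈ eigenspace (alpha θ) (eigval θ l) ∧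
      (eigenspace (alpha θ) (eigval θ l) : Set Alg) =
        (fun a => u l * a) '' (fixedPoints (alpha θ) : Set Alg) ∧
      (eigenspace (alpha θ) (eigval θ l) : Set Alg) =
        (fun a => a * u l) '' (fixedPoints (alpha θ) : Set Alg)) ∧
    -- the limits of the averages
    (∀ (f : Alg) (lam : Circle),
      (∀ l : ℤ, lam = eigval θ l → Tendsto (cesaro (alpha θ) lam f) atTop
        (𝓝 (ContinuousMap.const Circle (coefficient l f) * u l))) ∧
      (lam ∉ Set.range (eigval θ) → Tendsto (cesaro (alpha θ) lam f) atTop (𝓝 0))) := by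
  refine ⟨isUniquelyErgodicWithExpectation_of_tendsto (tendsto_cesaro_one hθ),
    coe_fixedPoints_alpha hθ, purePointSpectrum_alpha θ, fullPurePointSpectrum_alpha hθ,
    fun l => ⟨u_mem_unitary l, u_mem_eigenspace θ l, coe_eigenspace_alpha hθ l, ?_⟩,
    fun f lam => ⟨?_, fun h => tendsto_cesaro_of_notMem_range h f⟩⟩
  · rw [coe_eigenspace_alpha hθ l]
    simp only [u_mul_comm]
  · rintro l rfl
    rw [← eigenLimit_apply]
    exact tendsto_cesaro_eigval hθ l f
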